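/- **Setting.** Let $\Omega=\{1,\dots,n\}^{\mathbf Z^d}$ with the product topology, and let $Y\sim X$ ($Y$ is a *local excitation* of $X$) mean that $Y,X\in\Omega$ differ at only finitely many sites. A finite-range Hamiltonian $\Phi$ consists of chemical potentials $\Phi(s)$ and a translation-invariant two-body potential, which gives a pair of distinct sites $\{\mathbf a,\mathbf b\}$ an energy depending only on $\mathbf b-\mathbf a$ and on the two particles, and equal to zero if the Euclidean distance of $\mathbf a,\mathbf b$ exceeds some fixed number. For $Y\sim X$ the relative Hamiltonian is $$H_\Phi(Y,X)=\sum_{\mathbf a}\bigl(\Phi(Y(\mathbf a))-\Phi(X(\mathbf a))\bigr)+\sum_{\{\mathbf a,\mathbf b\}}\bigl(\Phi_{\{\mathbf a,\mathbf b\}}(Y)-\Phi_{\{\mathbf a,\mathbf b\}}(X)\bigr).$$ $X$ is a *ground-state configuration* of $\Phi$ if $H_\Phi(Y,X)\ge 0$ for all $Y\sim X$. A *ground state* of $\Phi$ is a weak limit, along some sequence of temperatures tending to zero, of translation-invariant Gibbs (DLR) states of $\Phi$. Let $\Phi$ be a finite-range Hamiltonian with zero chemical potentials whose pair energies all take values in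 $\{0,1\}$; pairs of energy $1$ are called *broken bonds*, and $B(Y)$ is the number of broken bonds of $Y$. Assume that there is exactly one translation-invariant probability measure $\mu$ on $\Omega$ supported by the ground-state configurations of $\Phi$, and that $\mu$-almost every configuration has no broken bonds. Let $r\in\mathbf R$. For a particle, or a pair of particles at given relative position, $ar$, and $Y\sim X$, let $n_{ar}(Y,X)$ be the number of appearances of $ar$ in $Y$ minus the number of its appearances in $X$ (only finitely many appearances are not common to both). The *strict boundary condition* for $ar$ says: there is $C_{ar}>0$ such that $$|n_{ar}(Y,X)|<C_{ar}\,B(Y)$$ for every configuration $X$ in the support of $\mu$ and every $Y\sim X$ with $Y\ne X$. **Theorem 1.** The following are equivalent. 1. The strict boundary condition holds for all particles and all pairs of particles at distance smaller than $r$. 2. (Stability of the ground state.) There is $\varepsilon>0$ such that for every perturbation $\Psi$ consisting of chemical potentials and translation-invariant two-body interactions vanishing at distances $\ge r$, all of absolute value $<\varepsilon$, the measure $\mu$ is the unique ground state of $\Phi+\Psi$. 3. There is $\varepsilon>0$ such that for every such perturbation $\Psi$, the measure $\mu$ is the unique translation-invariant probability measure supported by the ground-state configurations of $\Phi+\Psi$.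 -/

import Mathlib

noncomputable section

namespace LatticeGas

/-- Sites of the lattice `ℤ^d`. -/
abbrev Site (d : ℕ) : Type := Fin d → ℤ

/-- Infinite-lattice configurations: every site is occupied by one of `n` particles.  The space
carries the product topology and the product (Borel) sigma-algebra. -/
abbrev Config (d n : ℕ) : Type := Site d → Fin n

/-- Euclidean length of a lattice vector; the distance of the sites `a`, `b` is
`siteNorm (b - a)`. -/
def siteNorm {d : ℕ} (v : Site d) : ℝ := Real.sqrt (∑ i, ((v i : ℝ)) ^ 2)

/-- A translation-invariant finite-range Hamiltonian with chemical potentials `one` and a two-body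
potential `two`: `two v s t` is the energy of a particle `s` at a site `a` together with a
particle `t` at the site `a + v`.  As this is a function of the pair `{a, a + v}` and its
occupation, reading the pair in the other order gives the same energy. -/
@[ext]
structure Interaction (d n : ℕ) where
  one : Fin n → ℝ
  two : Site d → Fin n → Fin n → ℝ
  two_zero : ∀ s t, two 0 s t = 0
  two_symm : ∀ v s t, two (-v) t s = two v s t
  finite_range : ∃ R : ℝ, ∀ v, R < siteNorm v → ∀ s t, two v s t = 0

variable {d n : ℕ}

/-- The sum of two Hamiltonians. -/
def Interaction.add (Φ Ψ : Interaction d n) : Interaction d n where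
  one s := Φ.one s + Ψ.one s
  two v s t := Φ.two v s t + Ψ.two v s t
  two_zero s t := by rw [Φ.two_zero, Ψ.two_zero, add_zero]
  two_symm v s t := by rw [Φ.two_symm, Ψ.two_symm]
  finite_range := by
    obtain ⟨R₁, h₁⟩ := Φ.finite_range
    obtain ⟨R₂, h₂⟩ := Ψ.finite_range
    refine ⟨max R₁ R₂, fun v hv s t => ?_⟩
    rw [h₁ v (lt_of_le_of_lt (le_max_left _ _) hv), h₂ v (lt_of_le_of_lt (le_max_right _ _) hv),
      add_zero]

instance : Add (Interaction d n) := ⟨Interaction.add⟩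

/-- `Y` is a local excitation of `X`: the two differ at finitely many sites only. -/
def IsLocalExcitation (Y X : Config d n) : Prop := {a | Y a ≠ X a}.Finite

/-- The relative Hamiltonian `H(Y, X)`.  Every unordered pair of distinct sites occurs twice among
the ordered pairs `p`, hence the factor `1 / 2`.  If `Y` is a local excitation of `X`, then only
finitely many terms are nonzero. -/
def relEnergy (Φ : Interaction d n) (Y X : Config d n) : ℝ :=
  (∑ᶠ a : Site d, (Φ.one (Y a) - Φ.one (X a))) +
    (1 / 2) * ∑ᶠ p : Site d × Site d,
      (Φ.two (p.2 - p.1) (Y p.1) (Y p.2) - Φ.two (p.2 - p.1) (X p.1) (X p.2))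

/-- Ground-state configurations: the energy cannot be lowered by a local change. -/
def IsGroundStateConfig (Φ : Interaction d n) (X : Config d n) : Prop :=
  ∀ Y, IsLocalExcitation Y X → 0 ≤ relEnergy Φ Y X

/-! ### Ground states -/

/-- The translate of a configuration. -/
def translate (v : Site d) (X : Config d n) : Config d n := fun a => X (a + v)

/-- Translation invariance of a probability measure on configurations. -/
def IsTranslationInvariant (ν : MeasureTheory.ProbabilityMeasure (Config d n)) : Prop :=
  ∀ v : Site d, MeasureTheory.Measure.map (translate v)
    (ν : MeasureTheory.Measure (Config d n)) = ν

/-- A translation-invariant probability measure supported by the ground-state configurations. -/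
def IsGroundStateMeasure (Φ : Interaction d n)
    (ν : MeasureTheory.ProbabilityMeasure (Config d n)) : Prop :=
  IsTranslationInvariant ν ∧
    ∀ᵐ X ∂(ν : MeasureTheory.Measure (Config d n)), IsGroundStateConfig Φ X

/-- `ξ` inside the finite region `Λ`, `ω` outside. -/
def glue (Λ : Finset (Site d)) (ξ : Λ → Fin n) (ω : Config d n) : Config d n :=
  fun a => if h : a ∈ Λ then ξ ⟨a, h⟩ else ω a

/-- The Boltzmann weight of `ξ` in `Λ` with boundary condition `ω`.  Energies are measured
relative to `ω`, which cancels after normalization. -/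
def boltzmannWeight (Φ : Interaction d n) (β : ℝ) (Λ : Finset (Site d)) (ω : Config d n)
    (ξ : Λ → Fin n) : ℝ :=
  Real.exp (-β * relEnergy Φ (glue Λ ξ ω) ω)

/-- The grand-canonical ensemble in the finite region `Λ` with boundary condition `ω` outside `Λ`,
at inverse temperature `β`. -/
def finiteVolumeGibbs (Φ : Interaction d n) (β : ℝ) (Λ : Finset (Site d)) (ω : Config d n) :
    MeasureTheory.Measure (Config d n) :=
  ∑ ξ : Λ → Fin n,
    ENNReal.ofReal (boltzmannWeight Φ β Λ ω ξ / ∑ η : Λ → Fin n, boltzmannWeight Φ β Λ ω η) •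
      MeasureTheory.Measure.dirac (glue Λ ξ ω)

/-- Translation-invariant Gibbs states (equilibrium states) at inverse temperature `β`, through
the Dobrushin-Lanford-Ruelle equations. -/
def IsEquilibriumState (Φ : Interaction d n) (β : ℝ)
    (ν : MeasureTheory.ProbabilityMeasure (Config d n)) : Prop :=
  IsTranslationInvariant ν ∧
    ∀ (Λ : Finset (Site d)) (A : Set (Config d n)), MeasurableSet A →
      (ν : MeasureTheory.Measure (Config d n)) A =
        ∫⁻ ω, finiteVolumeGibbs Φ β Λ ω A ∂(ν : MeasureTheory.Measure (Config d n))

/-- Ground states: weak limits of equilibrium states as the temperature goes to zero, all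
interaction parameters being fixed. -/
def IsGroundState (Φ : Interaction d n)
    (ν : MeasureTheory.ProbabilityMeasure (Config d n)) : Prop :=
  ∃ (β : ℕ → ℝ) (ρ : ℕ → MeasureTheory.ProbabilityMeasure (Config d n)),
    Filter.Tendsto β Filter.atTop Filter.atTop ∧
    (∀ k, IsEquilibriumState Φ (β k) (ρ k)) ∧
    Filter.Tendsto ρ Filter.atTop (nhds ν)

/-- `μ` is the one and only ground state. -/
def HasUniqueGroundState (Φ : Interaction d n)
    (μ : MeasureTheory.ProbabilityMeasure (Config d n)) : Prop :=
  ∀ ν, IsGroundState Φ ν ↔ ν = μ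

/-- `μ` is the one and only translation-invariant probability measure supported by the
ground-state configurations. -/
def HasUniqueGroundStateMeasure (Φ : Interaction d n)
    (μ : MeasureTheory.ProbabilityMeasure (Config d n)) : Prop :=
  ∀ ν, IsGroundStateMeasure Φ ν ↔ ν = μ

/-! ### Broken bonds -/

/-- The unperturbed Hamiltonians: no chemical potentials, the minimal energy of a bond is
normalized to `0` and all other energies of a bond are normalized to `1`. -/
def IsBondHamiltonian (Φ : Interaction d n) : Prop :=
  (∀ s, Φ.one s = 0) ∧ ∀ v s t, Φ.two v s t = 0 ∨ Φ.two v s t = 1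

/-- The broken bonds of `Y`: the (unordered) pairs of sites with nonzero energy. -/
def brokenBonds (Φ : Interaction d n) (Y : Config d n) : Set (Sym2 (Site d)) :=
  {e | ∃ a b, e = s(a, b) ∧ Φ.two (b - a) (Y a) (Y b) ≠ 0}

/-- The number `B(Y)` of broken bonds (it is finite for a local excitation of a configuration
without broken bonds). -/
def numBrokenBonds (Φ : Interaction d n) (Y : Config d n) : ℕ := (brokenBonds Φ Y).ncard

/-! ### Strict boundary condition -/

/-- Arrangements: a particle `s`, or a particle `s` together with a particle `t` at the relative
position `v`. -/
inductive Arrangement (d n : ℕ) where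
  | particle (s : Fin n)
  | pair (v : Site d) (s t : Fin n)

/-- Particles, and pairs of particles at (positive) distance smaller than `r`. -/
def Arrangement.HasRangeLT (r : ℝ) : Arrangement d n → Prop
  | .particle _ => True
  | .pair v _ _ => v ≠ 0 ∧ siteNorm v < r

/-- The sites at which an arrangement appears in a configuration. -/
def Arrangement.occurrences : Arrangement d n → Config d n → Set (Site d)
  | .particle s, Y => {a | Y a = s}
  | .pair v s t, Y => {a | Y a = s ∧ Y (a + v) = t}

/-- `n_ar(Y, X)`: the number of appearances of `ar` in `Y` minus the number of its appearances in
`X`.  Both may be infinite, but for a local excitation they have all but finitely many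
appearances in common, and these are removed before counting. -/
def Arrangement.countDiff (ar : Arrangement d n) (Y X : Config d n) : ℤ :=
  ((ar.occurrences Y \ ar.occurrences X).ncard : ℤ) -
    ((ar.occurrences X \ ar.occurrences Y).ncard : ℤ)

/-- The strict boundary condition for local excitations and the arrangement `ar`.  The
ground-state configurations `X` are those in the support of the ground state `μ`, so that every
finite pattern of `X` has positive `μ`-probability; the constant `C` is uniform in `X`, `Y`.
The trivial excitation `Y = X`, for which both sides vanish, is excluded. -/
def StrictBoundaryCondition (Φ : Interaction d n)
    (μ : MeasureTheory.ProbabilityMeasure (Config d n)) (ar : Arrangement d n) : Prop :=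
  ∃ C : ℝ, 0 < C ∧
    ∀ X ∈ (μ : MeasureTheory.Measure (Config d n)).support,
      ∀ Y, IsLocalExcitation Y X → Y ≠ X →
        |(ar.countDiff Y X : ℝ)| < C * (numBrokenBonds Φ Y : ℝ)

/-! ### Stability -/

/-- `Ψ` consists of chemical potentials and two-body interactions of range smaller than `r`, all
of them smaller than `ε` in absolute value. -/
def IsSmallPerturbation (r ε : ℝ) (Ψ : Interaction d n) : Prop :=
  (∀ v, r ≤ siteNorm v → ∀ s t, Ψ.two v s t = 0) ∧
    (∀ s, |Ψ.one s| < ε) ∧ ∀ v s t, |Ψ.two v s t| < ε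

/-- Stability of the ground state: `μ` is the unique ground state of every sufficiently small
perturbation of the Hamiltonian. -/
def IsStableGroundState (Φ : Interaction d n) (r : ℝ)
    (μ : MeasureTheory.ProbabilityMeasure (Config d n)) : Prop :=
  ∃ ε : ℝ, 0 < ε ∧ ∀ Ψ, IsSmallPerturbation r ε Ψ → HasUniqueGroundState (Φ + Ψ) μ

/-- Stability at the level of ground-state configurations: for every sufficiently small
perturbation, `μ` is the unique translation-invariant probability measure supported by the
ground-state configurations of the perturbed Hamiltonian. -/
def IsStableGroundStateMeasure (Φ : Interaction d n) (r : ℝ)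
    (μ : MeasureTheory.ProbabilityMeasure (Config d n)) : Prop :=
  ∃ ε : ℝ, 0 < ε ∧ ∀ Ψ, IsSmallPerturbation r ε Ψ → HasUniqueGroundStateMeasure (Φ + Ψ) μ

end LatticeGas

end

noncomputable section

namespace LatticeGas

open MeasureTheory Filter Topology

variable {d n : ℕ}

/-! A configuration X in the support of μ has no broken bonds, so for a local excitation Y the
unperturbed energy H_Φ(Y,X) is exactly B(Y), while H_Ψ(Y,X) is a combination of finitely many counts
n_ar(Y,X) whose coefficients come from Ψ. Both directions compare these two quantities.

Strict boundary condition implies stability: for small Ψ the perturbation costs at most half of B(Y)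
(`exists_abs_relEnergy_le`), so H_{Φ+Ψ}(Y,X) ≥ B(Y)/2 and μ remains a ground-state measure. A
competing ground-state configuration is compared with one in the support of μ by exchanging their
contents in a large box. The exchange costs only a boundary term, which bounds the broken bonds in
the box. A competing translation-invariant measure therefore has zero density of broken bonds, hence
almost surely none, and equals μ.

Stability implies the strict boundary condition: a perturbation giving energy ±ε/2 to a single
arrangement turns the ground-state inequality into |n_ar| ≤ (2/ε) B(Y). Strictness needs B(Y) > 0
for Y ≠ X (`numBrokenBonds_pos`): otherwise a finite pattern of X could be removed everywhere
without breaking bonds, and a second ground-state measure would avoid that pattern.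

The two notions of stability are linked by two facts. Zero-temperature limits of equilibrium states
are ground-state measures (`IsGroundState.isGroundStateMeasure`), and by compactness at least one
ground state exists (`exists_isGroundState`). -/

/-! ### Boxes in the lattice. -/

/-- The cube of side `2 N + 1` centred at the origin. -/
def box (d N : ℕ) : Finset (Site d) := Finset.Icc (fun _ => -(N : ℤ)) (fun _ => (N : ℤ))

theorem mem_box {N : ℕ} {a : Site d} : a ∈ box d N ↔ ∀ i, |a i| ≤ N := by
  simp only [box, Finset.mem_Icc, Pi.le_def, abs_le, forall_and]

theorem zero_mem_box {N : ℕ} : (0 : Site d) ∈ box d N := by simp [mem_box]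

theorem neg_mem_box {N : ℕ} {a : Site d} (h : a ∈ box d N) : -a ∈ box d N := by
  simpa [mem_box] using h

theorem box_mono {M N : ℕ} (h : M ≤ N) : box d M ⊆ box d N := fun a ha => by
  rw [mem_box] at ha ⊢
  exact fun i => (ha i).trans (by exact_mod_cast h)

theorem add_mem_box {M N : ℕ} {a b : Site d} (ha : a ∈ box d M) (hb : b ∈ box d N) :
    a + b ∈ box d (M + N) := by
  rw [mem_box] at *
  intro i
  have := abs_add_le (a i) (b i)
  have := ha i
  have := hb i
  push_cast
  simp only [Pi.add_apply]
  linarith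

theorem add_notMem_box {M N : ℕ} {a v : Site d} (ha : a ∉ box d (M + N)) (hv : v ∈ box d N) :
    a + v ∉ box d M := fun h => ha (by simpa using add_mem_box h (neg_mem_box hv))

theorem card_box (N : ℕ) : (box d N).card = (2 * N + 1) ^ d := by
  rw [box, Pi.card_Icc]
  simp only [Int.card_Icc, Finset.prod_const, Finset.card_univ, Fintype.card_fin]
  congr 1
  omega

theorem card_box_pos (N : ℕ) : 0 < (box d N).card := by rw [card_box]; positivity

theorem exists_subset_box (s : Finset (Site d)) : ∃ N, s ⊆ box d N := by
  refine ⟨s.sup fun a => Finset.univ.sup fun i => (a i).natAbs, fun a ha => mem_box.2 fun i => ?_⟩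
  have h1 : (a i).natAbs ≤ Finset.univ.sup fun i => (a i).natAbs :=
    Finset.le_sup (f := fun i => (a i).natAbs) (Finset.mem_univ i)
  have h2 : (Finset.univ.sup fun i => (a i).natAbs) ≤
      s.sup fun a => Finset.univ.sup fun i => (a i).natAbs :=
    Finset.le_sup (f := fun a : Site d => Finset.univ.sup fun i => (a i).natAbs) ha
  rw [Int.abs_eq_natAbs]
  exact_mod_cast h1.trans h2

theorem abs_le_siteNorm (v : Site d) (i : Fin d) : (|v i| : ℝ) ≤ siteNorm v := by
  apply Real.abs_le_sqrt
  exact Finset.single_le_sum (f := fun i => ((v i : ℝ)) ^ 2) (fun _ _ => sq_nonneg _)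
    (Finset.mem_univ i)

theorem mem_box_of_siteNorm_le {N : ℕ} {v : Site d} (h : siteNorm v ≤ N) : v ∈ box d N := by
  rw [mem_box]
  intro i
  exact_mod_cast (abs_le_siteNorm v i).trans h

/-! ### Finite range and the relative energy as a sum of site energies. -/

/-- The pair interactions of `Φ` vanish outside `box d R`. -/
def HasRange (Φ : Interaction d n) (R : ℕ) : Prop := ∀ v ∉ box d R, ∀ s t, Φ.two v s t = 0

theorem exists_hasRange (Φ : Interaction d n) : ∃ R, HasRange Φ R := by
  obtain ⟨R, hR⟩ := Φ.finite_range
  obtain ⟨N, hN⟩ := exists_nat_ge R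
  refine ⟨N, fun v hv s t => hR v ?_ s t⟩
  by_contra! h
  exact hv (mem_box_of_siteNorm_le (h.trans hN))

theorem HasRange.mono {Φ : Interaction d n} {R R' : ℕ} (h : HasRange Φ R) (hR : R ≤ R') :
    HasRange Φ R' := fun v hv => h v fun h' => hv (box_mono hR h')

/-- The configurations agree near every site outside `Λ`. -/
def AgreeOff (Λ : Finset (Site d)) (R : ℕ) (Y X : Config d n) : Prop :=
  ∀ a ∉ Λ, ∀ v ∈ box d R, Y (a + v) = X (a + v)

theorem AgreeOff.apply {Λ : Finset (Site d)} {R : ℕ} {Y X : Config d n} (h : AgreeOff Λ R Y X)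
    {a : Site d} (ha : a ∉ Λ) : Y a = X a := by simpa using h a ha 0 zero_mem_box

theorem agreeOff_box {N R : ℕ} {Y X : Config d n} (h : ∀ a ∉ box d N, Y a = X a) :
    AgreeOff (box d (N + R)) R Y X := fun _ ha _ hv => h _ (add_notMem_box ha hv)

theorem IsLocalExcitation.exists_box {Y X : Config d n} (h : IsLocalExcitation Y X) :
    ∃ N, ∀ a ∉ box d N, Y a = X a := by
  obtain ⟨N, hN⟩ := exists_subset_box h.toFinset
  refine ⟨N, fun a ha => ?_⟩
  by_contra hne
  exact ha (hN (h.mem_toFinset.2 hne))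

theorem isLocalExcitation_of_eqOff {Λ : Finset (Site d)} {Y X : Config d n}
    (h : ∀ a ∉ Λ, Y a = X a) : IsLocalExcitation Y X :=
  Λ.finite_toSet.subset fun a ha => by
    by_contra hn
    exact ha (h a (by simpa using hn))

theorem IsLocalExcitation.exists_agreeOff {Y X : Config d n} (h : IsLocalExcitation Y X) (R : ℕ) :
    ∃ Λ : Finset (Site d), AgreeOff Λ R Y X := by
  obtain ⟨N, hN⟩ := h.exists_box
  exact ⟨_, agreeOff_box hN⟩

/-- The energy of the site `a`: each bond is shared evenly by its two endpoints. -/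
def siteEnergy (Φ : Interaction d n) (R : ℕ) (X : Config d n) (a : Site d) : ℝ :=
  Φ.one (X a) + 1 / 2 * ∑ v ∈ box d R, Φ.two v (X a) (X (a + v))

theorem siteEnergy_congr {Φ : Interaction d n} {R : ℕ} {X Y : Config d n} {a : Site d}
    (h : ∀ v ∈ box d R, Y (a + v) = X (a + v)) : siteEnergy Φ R Y a = siteEnergy Φ R X a := by
  have h0 : Y a = X a := by simpa using h 0 zero_mem_box
  unfold siteEnergy
  rw [h0]
  congr 2
  exact Finset.sum_congr rfl fun v hv => by rw [h v hv]

theorem siteEnergy_translate (Φ : Interaction d n) (R : ℕ) (X : Config d n) (a b : Site d) :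
    siteEnergy Φ R (translate b X) a = siteEnergy Φ R X (a + b) := by
  simp only [siteEnergy, translate, add_right_comm]

theorem siteEnergy_add (Φ Ψ : Interaction d n) (R : ℕ) (X : Config d n) (a : Site d) :
    siteEnergy (Φ + Ψ) R X a = siteEnergy Φ R X a + siteEnergy Ψ R X a := by
  have h1 : ∀ s, (Φ + Ψ).one s = Φ.one s + Ψ.one s := fun _ => rfl
  have h2 : ∀ v s t, (Φ + Ψ).two v s t = Φ.two v s t + Ψ.two v s t := fun _ _ _ => rfl
  simp only [siteEnergy, h1, h2, Finset.sum_add_distrib]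
  ring

theorem HasRange.add {Φ Ψ : Interaction d n} {R : ℕ} (hΦ : HasRange Φ R) (hΨ : HasRange Ψ R) :
    HasRange (Φ + Ψ) R := fun v hv s t => by
  change Φ.two v s t + Ψ.two v s t = 0
  rw [hΦ v hv, hΨ v hv, add_zero]

/-- Every bond is seen from both of its ends, and the factor 1/2 in `siteEnergy` is the one in
`relEnergy`. A site outside Λ sees the same surroundings in Y and X, so it contributes nothing. -/
theorem relEnergy_eq_sum {Φ : Interaction d n} {R : ℕ} (hR : HasRange Φ R) {Λ : Finset (Site d)}
    {Y X : Config d n} (h : AgreeOff Λ R Y X) :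
    relEnergy Φ Y X = ∑ a ∈ Λ, (siteEnergy Φ R Y a - siteEnergy Φ R X a) := by
  have h1 : ∑ᶠ a : Site d, (Φ.one (Y a) - Φ.one (X a)) =
      ∑ a ∈ Λ, (Φ.one (Y a) - Φ.one (X a)) := by
    apply finsum_eq_sum_of_support_subset
    intro a ha
    by_contra hn
    exact ha (by simp only [h.apply (Finset.mem_coe.not.1 hn), sub_self])
  -- An ordered pair of sites is described by its first site and its displacement, so that the
  -- finite range becomes a condition on one coordinate.
  let e : Site d × Site d ≃ Site d × Site d :=
    { toFun := fun p => (p.1, p.1 + p.2)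
      invFun := fun p => (p.1, p.2 - p.1)
      left_inv := fun p => by simp
      right_inv := fun p => by simp }
  have h2 : ∑ᶠ p : Site d × Site d,
      (Φ.two (p.2 - p.1) (Y p.1) (Y p.2) - Φ.two (p.2 - p.1) (X p.1) (X p.2)) =
      ∑ p ∈ Λ ×ˢ box d R, (Φ.two p.2 (Y p.1) (Y (p.1 + p.2)) -
        Φ.two p.2 (X p.1) (X (p.1 + p.2))) := by
    rw [← finsum_comp_equiv e]
    simp only [e, Equiv.coe_fn_mk, add_sub_cancel_left]
    apply finsum_eq_sum_of_support_subset
    rintro ⟨a, v⟩ hp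
    simp only [Finset.coe_product, Set.mem_prod, Finset.mem_coe]
    by_contra hn
    apply hp
    by_cases hv : v ∈ box d R
    · have ha : a ∉ Λ := fun ha => hn ⟨ha, hv⟩
      simp only [h a ha v hv, h.apply ha, sub_self]
    · simp only [hR v hv, sub_self]
  rw [relEnergy, h1, h2, Finset.sum_product, Finset.mul_sum, ← Finset.sum_add_distrib]
  refine Finset.sum_congr rfl fun a _ => ?_
  simp only [siteEnergy, Finset.sum_sub_distrib]
  ring

theorem relEnergy_add {Φ Ψ : Interaction d n} {Y X : Config d n} (h : IsLocalExcitation Y X) :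
    relEnergy (Φ + Ψ) Y X = relEnergy Φ Y X + relEnergy Ψ Y X := by
  obtain ⟨R₁, h₁⟩ := exists_hasRange Φ
  obtain ⟨R₂, h₂⟩ := exists_hasRange Ψ
  have h₁ := h₁.mono (le_max_left R₁ R₂)
  have h₂ := h₂.mono (le_max_right R₁ R₂)
  obtain ⟨Λ, hΛ⟩ := h.exists_agreeOff (max R₁ R₂)
  rw [relEnergy_eq_sum h₁ hΛ, relEnergy_eq_sum h₂ hΛ, relEnergy_eq_sum (h₁.add h₂) hΛ,
    ← Finset.sum_add_distrib]
  refine Finset.sum_congr rfl fun a _ => ?_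
  rw [siteEnergy_add, siteEnergy_add]
  ring

/-- Energies measured from different reference configurations are consistent. -/
theorem relEnergy_sub {Φ : Interaction d n} {Z Y X : Config d n} (hZ : IsLocalExcitation Z X)
    (hY : IsLocalExcitation Y X) : relEnergy Φ Z Y = relEnergy Φ Z X - relEnergy Φ Y X := by
  obtain ⟨R, hR⟩ := exists_hasRange Φ
  obtain ⟨M, hM⟩ := hZ.exists_box
  obtain ⟨N, hN⟩ := hY.exists_box
  have hM' : ∀ a ∉ box d (max M N), Z a = X a :=
    fun a ha => hM a fun h => ha (box_mono (le_max_left _ _) h)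
  have hN' : ∀ a ∉ box d (max M N), Y a = X a :=
    fun a ha => hN a fun h => ha (box_mono (le_max_right _ _) h)
  have hZY : ∀ a ∉ box d (max M N), Z a = Y a := fun a ha => (hM' a ha).trans (hN' a ha).symm
  rw [relEnergy_eq_sum hR (agreeOff_box hM'), relEnergy_eq_sum hR (agreeOff_box hN'),
    relEnergy_eq_sum hR (agreeOff_box hZY), ← Finset.sum_sub_distrib]
  exact Finset.sum_congr rfl fun a _ => by ring

/-! ### Counting arrangements -/

-- Replacing the two set differences by indicators makes the count additive over sites, so that it
-- can be matched with sums of local energies.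
open Classical in
theorem countDiff_eq_sum (ar : Arrangement d n) {Y X : Config d n} {Λ : Finset (Site d)}
    (h : ∀ a ∉ Λ, a ∈ ar.occurrences Y ↔ a ∈ ar.occurrences X) :
    (ar.countDiff Y X : ℝ) = ∑ a ∈ Λ, ((if a ∈ ar.occurrences Y then (1 : ℝ) else 0) -
      if a ∈ ar.occurrences X then 1 else 0) := by
  have key : ∀ Y X : Config d n, (∀ a ∉ Λ, a ∈ ar.occurrences Y ↔ a ∈ ar.occurrences X) →
      ((ar.occurrences Y \ ar.occurrences X).ncard : ℝ) =
        ∑ a ∈ Λ, if a ∈ ar.occurrences Y ∧ a ∉ ar.occurrences X then (1 : ℝ) else 0 := by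
    intro Y X h
    have : ar.occurrences Y \ ar.occurrences X =
        ↑(Λ.filter fun a => a ∈ ar.occurrences Y ∧ a ∉ ar.occurrences X) := by
      ext a
      simp only [Set.mem_sdiff, Finset.coe_filter, Set.mem_ofPred_eq]
      refine ⟨fun ha => ⟨?_, ha⟩, fun ha => ha.2⟩
      by_contra hn
      exact ha.2 ((h a hn).1 ha.1)
    rw [this, Set.ncard_coe_finset, Finset.card_filter]
    push_cast
    rfl
  unfold Arrangement.countDiff
  push_cast
  rw [key Y X h, key X Y fun a ha => (h a ha).symm, ← Finset.sum_sub_distrib]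
  refine Finset.sum_congr rfl fun a _ => ?_
  by_cases h1 : a ∈ ar.occurrences Y <;> by_cases h2 : a ∈ ar.occurrences X <;> simp [h1, h2]

/-- The relative Hamiltonian as a linear combination of arrangement counts. -/
theorem relEnergy_eq_countDiff {Ψ : Interaction d n} {R : ℕ} (hR : HasRange Ψ R)
    {Y X : Config d n} (h : IsLocalExcitation Y X) :
    relEnergy Ψ Y X = ∑ s, Ψ.one s * ((Arrangement.particle s).countDiff Y X : ℝ) +
      1 / 2 * ∑ v ∈ box d R, ∑ s, ∑ t,
        Ψ.two v s t * ((Arrangement.pair v s t).countDiff Y X : ℝ) := by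
  classical
  obtain ⟨Λ, hΛ⟩ := h.exists_agreeOff R
  rw [relEnergy_eq_sum hR hΛ]
  have h1 : ∀ s, ((Arrangement.particle s : Arrangement d n).countDiff Y X : ℝ) =
      ∑ a ∈ Λ, ((if Y a = s then (1 : ℝ) else 0) - if X a = s then 1 else 0) := fun s => by
    rw [countDiff_eq_sum (Λ := Λ)]
    · exact Finset.sum_congr rfl fun a _ => by congr
    · intro a ha
      simp only [Arrangement.occurrences, Set.mem_ofPred_eq, hΛ.apply ha]
  have h2 : ∀ v ∈ box d R, ∀ s t, ((Arrangement.pair v s t : Arrangement d n).countDiff Y X : ℝ) =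
      ∑ a ∈ Λ, ((if Y a = s ∧ Y (a + v) = t then (1 : ℝ) else 0) -
        if X a = s ∧ X (a + v) = t then 1 else 0) := fun v hv s t => by
    rw [countDiff_eq_sum (Λ := Λ)]
    · exact Finset.sum_congr rfl fun a _ => by congr
    · intro a ha
      simp only [Arrangement.occurrences, Set.mem_ofPred_eq, hΛ.apply ha, hΛ a ha v hv]
  have e1 : ∑ s, Ψ.one s * ((Arrangement.particle s : Arrangement d n).countDiff Y X : ℝ) =
      ∑ a ∈ Λ, (Ψ.one (Y a) - Ψ.one (X a)) := by
    simp only [h1, Finset.mul_sum]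
    rw [Finset.sum_comm]
    refine Finset.sum_congr rfl fun a _ => ?_
    simp [mul_sub, Finset.sum_sub_distrib]
  have e2 : ∑ v ∈ box d R, ∑ s, ∑ t,
        Ψ.two v s t * ((Arrangement.pair v s t : Arrangement d n).countDiff Y X : ℝ) =
      ∑ a ∈ Λ, ∑ v ∈ box d R,
        (Ψ.two v (Y a) (Y (a + v)) - Ψ.two v (X a) (X (a + v))) := by
    rw [Finset.sum_comm (s := Λ)]
    refine Finset.sum_congr rfl fun v hv => ?_
    have hone : ∀ Z : Config d n, ∀ a, ∑ s, ∑ t, Ψ.two v s t *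
        (if Z a = s ∧ Z (a + v) = t then (1 : ℝ) else 0) = Ψ.two v (Z a) (Z (a + v)) := by
      intro Z a
      simp [ite_and]
    simp only [h2 v hv, Finset.mul_sum]
    rw [Finset.sum_congr rfl fun s _ => Finset.sum_comm, Finset.sum_comm]
    refine Finset.sum_congr rfl fun a _ => ?_
    simp only [mul_sub, Finset.sum_sub_distrib, hone]
  rw [e1, e2, Finset.mul_sum, ← Finset.sum_add_distrib]
  refine Finset.sum_congr rfl fun a _ => ?_
  simp only [siteEnergy, Finset.sum_sub_distrib]
  ring

/-! ### Broken bonds -/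

/-- Off the diagonal, each unordered pair has exactly two orderings, and a symmetric set contains
both or neither. -/
theorem card_eq_two_mul_card_image_sym2 {α : Type*} [DecidableEq α] (s : Finset (α × α))
    (hs : ∀ p ∈ s, p.swap ∈ s) (hd : ∀ p ∈ s, p.1 ≠ p.2) :
    s.card = 2 * (s.image fun p => s(p.1, p.2)).card := by
  rw [Finset.card_eq_sum_card_image (fun p : α × α => s(p.1, p.2)) s, mul_comm,
    ← smul_eq_mul, ← Finset.sum_const]
  refine Finset.sum_congr rfl fun e he => ?_
  obtain ⟨⟨a, b⟩, hp, rfl⟩ := Finset.mem_image.1 he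
  rw [Finset.card_eq_two]
  refine ⟨(a, b), (b, a), fun h => hd _ hp (Prod.ext_iff.1 h).1, ?_⟩
  ext ⟨x, y⟩
  simp only [Finset.mem_filter, Sym2.eq_iff, Finset.mem_insert, Finset.mem_singleton,
    Prod.mk.injEq]
  constructor
  · exact fun h => h.2
  · rintro (⟨rfl, rfl⟩ | ⟨rfl, rfl⟩)
    · exact ⟨hp, Or.inl ⟨rfl, rfl⟩⟩
    · exact ⟨hs _ hp, Or.inr ⟨rfl, rfl⟩⟩

theorem two_swap (Φ : Interaction d n) (a b : Site d) (s t : Fin n) :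
    Φ.two (b - a) s t = Φ.two (a - b) t s := by
  rw [← Φ.two_symm (a - b), neg_sub]

theorem brokenBonds_eq_empty_iff {Φ : Interaction d n} {X : Config d n} :
    brokenBonds Φ X = ∅ ↔ ∀ a v, Φ.two v (X a) (X (a + v)) = 0 := by
  rw [Set.eq_empty_iff_forall_notMem]
  constructor
  · intro h a v
    by_contra hne
    exact h s(a, a + v) ⟨a, a + v, rfl, by simpa using hne⟩
  · rintro h e ⟨a, b, rfl, hne⟩
    exact hne (by simpa using h a (b - a))

theorem IsBondHamiltonian.two_nonneg {Φ : Interaction d n} (hΦ : IsBondHamiltonian Φ)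
    (v : Site d) (s t : Fin n) : 0 ≤ Φ.two v s t := by
  rcases hΦ.2 v s t with h | h <;> simp [h]

theorem siteEnergy_of_isBond {Φ : Interaction d n} (hΦ : IsBondHamiltonian Φ) (R : ℕ)
    (X : Config d n) (a : Site d) :
    siteEnergy Φ R X a = 1 / 2 * ∑ v ∈ box d R, Φ.two v (X a) (X (a + v)) := by
  rw [siteEnergy, hΦ.1, zero_add]

theorem siteEnergy_nonneg {Φ : Interaction d n} (hΦ : IsBondHamiltonian Φ) (R : ℕ)
    (X : Config d n) (a : Site d) : 0 ≤ siteEnergy Φ R X a := by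
  rw [siteEnergy_of_isBond hΦ]
  exact mul_nonneg (by norm_num) (Finset.sum_nonneg fun v _ => hΦ.two_nonneg _ _ _)

theorem brokenBonds_eq_empty_iff_siteEnergy {Φ : Interaction d n} (hΦ : IsBondHamiltonian Φ)
    {R : ℕ} (hR : HasRange Φ R) {X : Config d n} :
    brokenBonds Φ X = ∅ ↔ ∀ a, siteEnergy Φ R X a = 0 := by
  rw [brokenBonds_eq_empty_iff]
  refine forall_congr' fun a => ?_
  rw [siteEnergy_of_isBond hΦ]
  constructor
  · intro h
    simp [h]
  · intro h v
    by_cases hv : v ∈ box d R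
    · have h' : ∑ v ∈ box d R, Φ.two v (X a) (X (a + v)) = 0 := by linarith
      exact (Finset.sum_eq_zero_iff_of_nonneg fun v _ => hΦ.two_nonneg _ _ _).1 h' v hv
    · exact hR v hv _ _

/-- A broken bond has energy 1, half of it at each end. The values 0 and 1 are what identify an
energy sum with a cardinality. -/
theorem numBrokenBonds_eq_sum {Φ : Interaction d n} (hΦ : IsBondHamiltonian Φ) {R : ℕ}
    (hR : HasRange Φ R) {Y : Config d n} {Λ : Finset (Site d)}
    (h : ∀ a ∉ Λ, siteEnergy Φ R Y a = 0) :
    (numBrokenBonds Φ Y : ℝ) = ∑ a ∈ Λ, siteEnergy Φ R Y a := by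
  classical
  have h0 : ∀ a ∉ Λ, ∀ v, Φ.two v (Y a) (Y (a + v)) = 0 := by
    intro a ha v
    by_cases hv : v ∈ box d R
    · have h1 := h a ha
      rw [siteEnergy_of_isBond hΦ] at h1
      have h2 : ∑ v ∈ box d R, Φ.two v (Y a) (Y (a + v)) = 0 := by linarith
      exact (Finset.sum_eq_zero_iff_of_nonneg fun v _ => hΦ.two_nonneg _ _ _).1 h2 v hv
    · exact hR v hv _ _
  -- The broken bonds as ordered pairs: the first site must lie in Λ and the displacement in the
  -- range, so they form a finite set, twice as large as the set of unordered bonds.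
  let S : Finset (Site d × Site d) := ((Λ ×ˢ box d R).image fun p => (p.1, p.1 + p.2)).filter
    fun p => Φ.two (p.2 - p.1) (Y p.1) (Y p.2) ≠ 0
  have hS : ∀ p : Site d × Site d, p ∈ S ↔ Φ.two (p.2 - p.1) (Y p.1) (Y p.2) ≠ 0 := by
    rintro ⟨a, b⟩
    simp only [S, Finset.mem_filter, and_iff_right_iff_imp]
    intro hne
    refine Finset.mem_image.2 ⟨(a, b - a), Finset.mem_product.2 ⟨?_, ?_⟩, by simp⟩
    · by_contra ha
      exact hne (by simpa using h0 a ha (b - a))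
    · by_contra hv
      exact hne (hR _ hv _ _)
  have hset : brokenBonds Φ Y = ↑(S.image fun p => s(p.1, p.2)) := by
    ext e
    simp only [brokenBonds, Set.mem_ofPred_eq, Finset.coe_image, Set.mem_image, Finset.mem_coe,
      hS, Prod.exists]
    exact ⟨fun ⟨a, b, he, hne⟩ => ⟨a, b, hne, he.symm⟩, fun ⟨a, b, hne, he⟩ => ⟨a, b, he.symm, hne⟩⟩
  have hcard := card_eq_two_mul_card_image_sym2 S
    (fun p hp => by
      rw [hS] at hp ⊢
      rwa [Prod.fst_swap, Prod.snd_swap, two_swap])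
    (fun p hp heq => by
      rw [hS, heq, sub_self, Φ.two_zero] at hp
      exact hp rfl)
  have hsum : (S.card : ℝ) = ∑ a ∈ Λ, ∑ v ∈ box d R, Φ.two v (Y a) (Y (a + v)) := by
    rw [Finset.card_filter, Finset.sum_image, ← Finset.sum_product']
    · push_cast
      refine Finset.sum_congr rfl fun p _ => ?_
      rw [add_sub_cancel_left]
      rcases hΦ.2 p.2 (Y p.1) (Y (p.1 + p.2)) with h | h <;> simp [h]
    · rintro ⟨a, v⟩ _ ⟨b, w⟩ _ heq
      simp only [Prod.mk.injEq] at heq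
      obtain ⟨rfl, h2⟩ := heq
      simpa using h2
  rw [numBrokenBonds, hset, Set.ncard_coe_finset]
  simp only [siteEnergy_of_isBond hΦ, ← Finset.mul_sum, ← hsum, hcard]
  push_cast
  ring

theorem relEnergy_eq_numBrokenBonds {Φ : Interaction d n} (hΦ : IsBondHamiltonian Φ)
    {Y X : Config d n} (h : IsLocalExcitation Y X) (hX : brokenBonds Φ X = ∅) :
    relEnergy Φ Y X = numBrokenBonds Φ Y := by
  obtain ⟨R, hR⟩ := exists_hasRange Φ
  obtain ⟨Λ, hΛ⟩ := h.exists_agreeOff R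
  have hX := (brokenBonds_eq_empty_iff_siteEnergy hΦ hR).1 hX
  rw [relEnergy_eq_sum hR hΛ, numBrokenBonds_eq_sum hΦ hR (Λ := Λ)]
  · simp [hX]
  · intro a ha
    rw [siteEnergy_congr (hΛ a ha), hX]

theorem isGroundStateConfig_of_brokenBonds_eq_empty {Φ : Interaction d n}
    (hΦ : IsBondHamiltonian Φ) {X : Config d n} (hX : brokenBonds Φ X = ∅) :
    IsGroundStateConfig Φ X := fun Y hY => by
  rw [relEnergy_eq_numBrokenBonds hΦ hY hX]
  positivity

/-! ### Continuity -/

theorem continuous_translate (v : Site d) : Continuous (translate v : Config d n → Config d n) :=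
  continuous_pi fun a => continuous_apply (a + v)

theorem continuous_siteEnergy (Φ : Interaction d n) (R : ℕ) (a : Site d) :
    Continuous fun X : Config d n => siteEnergy Φ R X a := by
  unfold siteEnergy
  refine ((continuous_of_discreteTopology (f := Φ.one)).comp (continuous_apply a)).add
    (continuous_const.mul (continuous_finsetSum _ fun v _ => ?_))
  have h : Continuous fun X : Config d n => (X a, X (a + v)) :=
    (continuous_apply a).prodMk (continuous_apply (a + v))
  exact (continuous_of_discreteTopology (f := fun p : Fin n × Fin n => Φ.two v p.1 p.2)).comp h

theorem glue_apply_of_notMem {Λ : Finset (Site d)} {ξ : Λ → Fin n} {ω : Config d n} {a : Site d}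
    (h : a ∉ Λ) : glue Λ ξ ω a = ω a := dif_neg h

theorem glue_apply_of_mem {Λ : Finset (Site d)} {ξ : Λ → Fin n} {ω : Config d n} {a : Site d}
    (h : a ∈ Λ) : glue Λ ξ ω a = ξ ⟨a, h⟩ := dif_pos h

theorem continuous_glue (Λ : Finset (Site d)) (ξ : Λ → Fin n) :
    Continuous (glue Λ ξ : Config d n → Config d n) := by
  refine continuous_pi fun a => ?_
  by_cases h : a ∈ Λ
  · simp only [glue_apply_of_mem h]
    exact continuous_const
  · simp only [glue_apply_of_notMem h]
    exact continuous_apply a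

theorem isLocalExcitation_glue (Λ : Finset (Site d)) (ξ : Λ → Fin n) (ω : Config d n) :
    IsLocalExcitation (glue Λ ξ ω) ω :=
  isLocalExcitation_of_eqOff fun _ h => glue_apply_of_notMem h

theorem glue_restrict_eq {Λ : Finset (Site d)} {Y X : Config d n} (h : ∀ a ∉ Λ, Y a = X a) :
    glue Λ (fun a => Y a) X = Y := by
  funext a
  by_cases ha : a ∈ Λ
  · exact glue_apply_of_mem ha
  · rw [glue_apply_of_notMem ha, h a ha]

theorem continuous_relEnergy_glue (Φ : Interaction d n) (Λ : Finset (Site d)) (ξ : Λ → Fin n) :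
    Continuous fun ω => relEnergy Φ (glue Λ ξ ω) ω := by
  obtain ⟨R, hR⟩ := exists_hasRange Φ
  obtain ⟨N, hN⟩ := exists_subset_box Λ
  have h : ∀ ω, relEnergy Φ (glue Λ ξ ω) ω =
      ∑ a ∈ box d (N + R), (siteEnergy Φ R (glue Λ ξ ω) a - siteEnergy Φ R ω a) := fun ω =>
    relEnergy_eq_sum hR (agreeOff_box fun a ha => glue_apply_of_notMem fun h => ha (hN h))
  simp only [h]
  exact continuous_finsetSum _ fun a _ =>
    ((continuous_siteEnergy Φ R a).comp (continuous_glue Λ ξ)).sub (continuous_siteEnergy Φ R a)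

/-- Indexing the excitations by a region and a filling leaves countably many conditions, each
continuous in X. Closedness and almost-everywhere statements then hold condition by condition. -/
theorem isGroundStateConfig_iff_glue {Φ : Interaction d n} {X : Config d n} :
    IsGroundStateConfig Φ X ↔
      ∀ (Λ : Finset (Site d)) (ξ : Λ → Fin n), 0 ≤ relEnergy Φ (glue Λ ξ X) X := by
  refine ⟨fun h Λ ξ => h _ (isLocalExcitation_glue Λ ξ X), fun h Y hY => ?_⟩
  obtain ⟨N, hN⟩ := hY.exists_box
  rw [← glue_restrict_eq hN]
  exact h _ _

theorem isClosed_setOf_isGroundStateConfig (Φ : Interaction d n) :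
    IsClosed {X | IsGroundStateConfig Φ X} := by
  simp only [isGroundStateConfig_iff_glue, Set.ofPred_forall]
  exact isClosed_iInter fun Λ => isClosed_iInter fun ξ =>
    isClosed_le continuous_const (continuous_relEnergy_glue Φ Λ ξ)

theorem isClosed_setOf_brokenBonds_eq_empty {Φ : Interaction d n} (hΦ : IsBondHamiltonian Φ) :
    IsClosed {X | brokenBonds Φ X = ∅} := by
  obtain ⟨R, hR⟩ := exists_hasRange Φ
  simp only [brokenBonds_eq_empty_iff_siteEnergy hΦ hR, Set.ofPred_forall]
  exact isClosed_iInter fun a => isClosed_eq (continuous_siteEnergy Φ R a) continuous_const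

/-! ### The Gibbs specification -/

theorem boltzmannWeight_pos (Φ : Interaction d n) (β : ℝ) (Λ : Finset (Site d)) (ω : Config d n)
    (ξ : Λ → Fin n) : 0 < boltzmannWeight Φ β Λ ω ξ := Real.exp_pos _

/-- The normalized Boltzmann weight. -/
def gibbsProb (Φ : Interaction d n) (β : ℝ) (Λ : Finset (Site d)) (ω : Config d n)
    (ξ : Λ → Fin n) : ℝ :=
  boltzmannWeight Φ β Λ ω ξ / ∑ η : Λ → Fin n, boltzmannWeight Φ β Λ ω η

theorem partition_pos (Φ : Interaction d n) (β : ℝ) (Λ : Finset (Site d)) (ω : Config d n) :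
    0 < ∑ η : Λ → Fin n, boltzmannWeight Φ β Λ ω η :=
  Finset.sum_pos (fun _ _ => boltzmannWeight_pos _ _ _ _ _) ⟨fun a => ω a, Finset.mem_univ _⟩

theorem gibbsProb_nonneg (Φ : Interaction d n) (β : ℝ) (Λ : Finset (Site d)) (ω : Config d n)
    (ξ : Λ → Fin n) : 0 ≤ gibbsProb Φ β Λ ω ξ :=
  div_nonneg (boltzmannWeight_pos _ _ _ _ _).le (partition_pos _ _ _ _).le

theorem sum_gibbsProb (Φ : Interaction d n) (β : ℝ) (Λ : Finset (Site d)) (ω : Config d n) :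
    ∑ ξ, gibbsProb Φ β Λ ω ξ = 1 := by
  simp only [gibbsProb, ← Finset.sum_div]
  exact div_self (partition_pos _ _ _ _).ne'

theorem continuous_gibbsProb (Φ : Interaction d n) (β : ℝ) (Λ : Finset (Site d))
    (ξ : Λ → Fin n) : Continuous fun ω => gibbsProb Φ β Λ ω ξ := by
  have h : ∀ ξ : Λ → Fin n, Continuous fun ω => boltzmannWeight Φ β Λ ω ξ := fun ξ =>
    Real.continuous_exp.comp (continuous_const.mul (continuous_relEnergy_glue Φ Λ ξ))
  exact (h ξ).div (continuous_finsetSum _ fun η _ => h η) fun ω => (partition_pos _ _ _ _).ne'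

/-- Overwriting η by ξ gains at least δ, so the weight of ξ is at least exp(βδ) times that of η, and
the partition function is at least the weight of ξ. -/
theorem gibbsProb_le_exp {Φ : Interaction d n} {β : ℝ} (hβ : 0 ≤ β) {Λ : Finset (Site d)}
    {ω : Config d n} {ξ η : Λ → Fin n} {δ : ℝ}
    (h : relEnergy Φ (glue Λ ξ (glue Λ η ω)) (glue Λ η ω) ≤ -δ) :
    gibbsProb Φ β Λ ω η ≤ Real.exp (-(β * δ)) := by
  have hg : glue Λ ξ (glue Λ η ω) = glue Λ ξ ω := by
    funext a
    by_cases ha : a ∈ Λ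
    · rw [glue_apply_of_mem ha, glue_apply_of_mem ha]
    · simp only [glue_apply_of_notMem ha]
  rw [hg, relEnergy_sub (isLocalExcitation_glue Λ ξ ω) (isLocalExcitation_glue Λ η ω)] at h
  rw [gibbsProb, div_le_iff₀ (partition_pos _ _ _ _)]
  have h1 : boltzmannWeight Φ β Λ ω ξ ≤ ∑ η : Λ → Fin n, boltzmannWeight Φ β Λ ω η :=
    Finset.single_le_sum (fun η _ => (boltzmannWeight_pos Φ β Λ ω η).le) (Finset.mem_univ ξ)
  refine le_trans ?_ (mul_le_mul_of_nonneg_left h1 (Real.exp_pos _).le)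
  rw [boltzmannWeight, boltzmannWeight, ← Real.exp_add, Real.exp_le_exp]
  nlinarith

theorem finiteVolumeGibbs_apply (Φ : Interaction d n) (β : ℝ) (Λ : Finset (Site d))
    (ω : Config d n) {A : Set (Config d n)} (hA : MeasurableSet A) :
    finiteVolumeGibbs Φ β Λ ω A =
      ∑ ξ, ENNReal.ofReal (gibbsProb Φ β Λ ω ξ) * A.indicator 1 (glue Λ ξ ω) := by
  simp only [finiteVolumeGibbs, Measure.coe_finsetSum, Finset.sum_apply, Measure.smul_apply,
    Measure.dirac_apply' _ hA, smul_eq_mul, gibbsProb]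

/-! ### Zero-temperature limits are supported by ground-state configurations -/

/-- By the DLR equation it suffices to bound the event in finite volume. Each filling η of Λ that
produces it can be improved by δ on overwriting with ξ, hence is exponentially unlikely, and there
are finitely many fillings. -/
theorem equilibrium_measure_le {Φ : Interaction d n} {β : ℝ} (hβ : 0 ≤ β)
    {ρ : ProbabilityMeasure (Config d n)} (hρ : IsEquilibriumState Φ β ρ)
    (Λ : Finset (Site d)) (ξ : Λ → Fin n) (δ : ℝ) :
    (ρ : Measure (Config d n)) {ω | relEnergy Φ (glue Λ ξ ω) ω < -δ} ≤
      ENNReal.ofReal (Fintype.card (Λ → Fin n) * Real.exp (-(β * δ))) := by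
  have hA : MeasurableSet {ω : Config d n | relEnergy Φ (glue Λ ξ ω) ω < -δ} :=
    (isOpen_lt (continuous_relEnergy_glue Φ Λ ξ) continuous_const).measurableSet
  rw [hρ.2 Λ _ hA]
  have hle : ∀ ω, finiteVolumeGibbs Φ β Λ ω {ω | relEnergy Φ (glue Λ ξ ω) ω < -δ} ≤
      ENNReal.ofReal (Fintype.card (Λ → Fin n) * Real.exp (-(β * δ))) := by
    intro ω
    rw [finiteVolumeGibbs_apply _ _ _ _ hA]
    refine (Finset.sum_le_card_nsmul Finset.univ _ (ENNReal.ofReal (Real.exp (-(β * δ))))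
      fun η _ => ?_).trans (le_of_eq ?_)
    · by_cases hη : glue Λ η ω ∈ {ω | relEnergy Φ (glue Λ ξ ω) ω < -δ}
      · rw [Set.indicator_of_mem hη, Pi.one_apply, mul_one]
        exact ENNReal.ofReal_le_ofReal (gibbsProb_le_exp hβ (Set.mem_ofPred.1 hη).le)
      · rw [Set.indicator_of_notMem hη, mul_zero]
        exact zero_le
    · rw [ENNReal.ofReal_mul (by positivity), ENNReal.ofReal_natCast, nsmul_eq_mul,
        Finset.card_univ]
  refine (lintegral_mono hle).trans ?_
  simp

theorem isTranslationInvariant_of_tendsto {ι : Type*} {l : Filter ι} [l.NeBot]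
    {ρ : ι → ProbabilityMeasure (Config d n)} {ν : ProbabilityMeasure (Config d n)}
    (hρ : ∀ k, IsTranslationInvariant (ρ k)) (h : Tendsto ρ l (𝓝 ν)) :
    IsTranslationInvariant ν := by
  intro v
  have h1 := ProbabilityMeasure.tendsto_map_of_tendsto_of_continuous ρ ν h
    (continuous_translate (n := n) v)
  have h2 : ∀ k, (ρ k).map (continuous_translate (n := n) v).measurable.aemeasurable = ρ k :=
    fun k => Subtype.ext (hρ k v)
  simp only [h2] at h1
  exact congrArg (fun m : ProbabilityMeasure (Config d n) => (m : Measure (Config d n)))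
    (tendsto_nhds_unique h1 h)

theorem IsGroundState.isGroundStateMeasure {Φ : Interaction d n}
    {ν : ProbabilityMeasure (Config d n)} (h : IsGroundState Φ ν) : IsGroundStateMeasure Φ ν := by
  obtain ⟨β, ρ, hβ, hρ, hlim⟩ := h
  refine ⟨isTranslationInvariant_of_tendsto (fun k => (hρ k).1) hlim, ?_⟩
  simp only [isGroundStateConfig_iff_glue]
  rw [ae_all_iff]
  intro Λ
  rw [ae_all_iff]
  intro ξ
  -- A fixed gap 1/(m+1) serves two purposes: the exceptional set is open, so the portmanteau
  -- inequality applies, and its probability decays exponentially in β. Letting m grow removes the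
  -- gap.
  have hm : ∀ m : ℕ, ∀ᵐ ω ∂(ν : Measure (Config d n)),
      -(1 / ((m : ℝ) + 1)) ≤ relEnergy Φ (glue Λ ξ ω) ω := by
    intro m
    simp only [ae_iff, not_le]
    have hopen : IsOpen {ω : Config d n | relEnergy Φ (glue Λ ξ ω) ω < -(1 / ((m : ℝ) + 1))} :=
      isOpen_lt (continuous_relEnergy_glue Φ Λ ξ) continuous_const
    have h1 := ProbabilityMeasure.le_liminf_measure_open_of_tendsto hlim hopen
    have h2 : Tendsto (fun k => ENNReal.ofReal
        (Fintype.card (Λ → Fin n) * Real.exp (-(β k * (1 / ((m : ℝ) + 1)))))) atTop (𝓝 0) := by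
      rw [← ENNReal.ofReal_zero]
      refine ENNReal.tendsto_ofReal ?_
      have h3 := (Real.tendsto_exp_neg_atTop_nhds_zero.comp
        (hβ.atTop_mul_const (show 0 < 1 / ((m : ℝ) + 1) by positivity))).const_mul
          (Fintype.card (Λ → Fin n) : ℝ)
      simpa using h3
    have h3 : Tendsto (fun k => (ρ k : Measure (Config d n))
        {ω | relEnergy Φ (glue Λ ξ ω) ω < -(1 / ((m : ℝ) + 1))}) atTop (𝓝 0) :=
      tendsto_of_tendsto_of_tendsto_of_le_of_le' tendsto_const_nhds h2
        (Eventually.of_forall fun _ => zero_le)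
        ((hβ.eventually_ge_atTop 0).mono fun k hk => equilibrium_measure_le hk (hρ k) Λ ξ _)
    rw [h3.liminf_eq] at h1
    exact le_antisymm h1 zero_le
  rw [← ae_all_iff] at hm
  filter_upwards [hm] with ω hω
  have hlim := (tendsto_one_div_add_atTop_nhds_zero_nat (𝕜 := ℝ)).neg
  rw [neg_zero] at hlim
  exact le_of_tendsto' hlim hω

/-! ### Averages over large boxes -/

/-- The boundary layer of a box is negligible against its volume; this kills all boundary terms
below. -/
theorem tendsto_card_box_ratio (k : ℕ) :
    Tendsto (fun N => ((box d (N + k)).card : ℝ) / (box d N).card) atTop (𝓝 1) := by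
  have h : ∀ N : ℕ, ((box d (N + k)).card : ℝ) / (box d N).card =
      (1 + (2 * k : ℝ) / (2 * (N : ℝ) + 1)) ^ d := by
    intro N
    rw [card_box, card_box]
    push_cast
    rw [← div_pow]
    congr 1
    field_simp
    ring
  simp only [h]
  have h1 : Tendsto (fun N : ℕ => (2 * k : ℝ) / (2 * (N : ℝ) + 1)) atTop (𝓝 0) :=
    tendsto_const_nhds.div_atTop (tendsto_atTop_add_const_right _ _
      (tendsto_natCast_atTop_atTop.const_mul_atTop (by norm_num)))
  simpa using (h1.const_add 1).pow d

theorem abs_sum_box_sub_le {f : Site d → ℝ} {M : ℝ} (hf : ∀ a, |f a| ≤ M) {N k : ℕ}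
    {s : Finset (Site d)} (hs : s ⊆ box d (N + k)) (hcard : s.card = (box d N).card) :
    |∑ a ∈ box d (N + k), f a - ∑ a ∈ s, f a| ≤
      M * ((box d (N + k)).card - (box d N).card) := by
  rw [← Finset.sum_sdiff hs, add_sub_cancel_right]
  refine (Finset.abs_sum_le_sum_abs _ _).trans
    ((Finset.sum_le_card_nsmul _ _ M fun a _ => hf a).trans (le_of_eq ?_))
  rw [nsmul_eq_mul, Finset.cast_card_sdiff hs, hcard, mul_comm]

/-- The box and its translate are equally large subsets of one slightly larger box, so each sum
differs from the sum over that box only by a boundary layer. -/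
theorem abs_sum_box_shift_le {f : Site d → ℝ} {M : ℝ} (hf : ∀ a, |f a| ≤ M) {N k : ℕ}
    {v : Site d} (hv : v ∈ box d k) :
    |∑ a ∈ box d N, f (a + v) - ∑ a ∈ box d N, f a| ≤
      2 * M * ((box d (N + k)).card - (box d N).card) := by
  classical
  have h1 : ∑ a ∈ box d N, f (a + v) = ∑ a ∈ (box d N).map (addRightEmbedding v), f a := by
    simp
  have h2 := abs_sum_box_sub_le hf (N := N) (k := k) (s := (box d N).map (addRightEmbedding v))
    (fun a ha => by
      obtain ⟨b, hb, rfl⟩ := Finset.mem_map.1 ha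
      exact add_mem_box hb hv) (Finset.card_map _)
  have h3 := abs_sum_box_sub_le hf (N := N) (k := k) (box_mono (Nat.le_add_right N k)) rfl
  rw [h1]
  rw [abs_le] at *
  constructor <;> linarith

/-- The average of the translates of `ν` by the sites of a box. -/
def boxAverage (N : ℕ) (ν : ProbabilityMeasure (Config d n)) :
    ProbabilityMeasure (Config d n) :=
  ⟨((box d N).card : ENNReal)⁻¹ •
      ∑ a ∈ box d N, Measure.map (translate a) (ν : Measure (Config d n)), ⟨by
    have h : ∀ a, Measure.map (translate a) (ν : Measure (Config d n)) Set.univ = 1 := fun a => by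
      rw [Measure.map_apply (continuous_translate a).measurable MeasurableSet.univ,
        Set.preimage_univ, measure_univ]
    simp only [Measure.smul_apply, Measure.coe_finsetSum, Finset.sum_apply, h, smul_eq_mul,
      Finset.sum_const, nsmul_eq_mul, mul_one]
    exact ENNReal.inv_mul_cancel (by exact_mod_cast (card_box_pos N).ne') (by simp)⟩⟩

theorem integrable_of_continuous {f : Config d n → ℝ} (hf : Continuous f)
    (ν : Measure (Config d n)) [IsFiniteMeasure ν] : Integrable f ν := by
  simpa using hf.continuousOn.integrableOn_compact (μ := ν) isCompact_univ

theorem exists_abs_le_of_continuous {f : Config d n → ℝ} (hf : Continuous f) :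
    ∃ M, ∀ X, |f X| ≤ M := by
  obtain ⟨M, hM⟩ := isCompact_univ.exists_bound_of_continuousOn hf.continuousOn
  exact ⟨M, fun X => hM X trivial⟩

theorem integral_boxAverage (N : ℕ) (ν : ProbabilityMeasure (Config d n))
    {f : Config d n → ℝ} (hf : Continuous f) :
    ∫ X, f X ∂(boxAverage N ν : Measure (Config d n)) =
      ((box d N).card : ℝ)⁻¹ * ∑ a ∈ box d N, ∫ X, f (translate a X) ∂(ν : Measure (Config d n)) := by
  change ∫ X, f X ∂(((box d N).card : ENNReal)⁻¹ •
      ∑ a ∈ box d N, Measure.map (translate a) (ν : Measure (Config d n))) = _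
  rw [integral_smul_measure, integral_finsetSum_measure]
  · simp only [ENNReal.toReal_inv, ENNReal.toReal_natCast, smul_eq_mul]
    congr 1
    refine Finset.sum_congr rfl fun a _ => ?_
    rw [integral_map (continuous_translate a).measurable.aemeasurable
      hf.aestronglyMeasurable]
  · intro a _
    have := Measure.isFiniteMeasure_map (ν : Measure (Config d n))
      (translate (n := n) a)
    exact integrable_of_continuous hf _

/-- A limit along an ultrafilter finer than `atTop` needs compactness only, and properties holding
for all large indices can be used along it. -/
theorem exists_ultrafilter_tendsto {α : Type*} [TopologicalSpace α] [CompactSpace α]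
    (ρ : ℕ → α) :
    ∃ (U : Ultrafilter ℕ) (x : α), (U : Filter ℕ) ≤ atTop ∧ Tendsto ρ U (𝓝 x) := by
  obtain ⟨x, -, hx⟩ := isCompact_univ.ultrafilter_le_nhds
    ((Ultrafilter.of (atTop : Filter ℕ)).map ρ) (by simp)
  exact ⟨_, x, Ultrafilter.of_le _, hx⟩

theorem tendsto_integral_of_tendsto {ι : Type*} {l : Filter ι}
    {ρ : ι → ProbabilityMeasure (Config d n)} {ν : ProbabilityMeasure (Config d n)}
    (h : Tendsto ρ l (𝓝 ν)) {f : Config d n → ℝ} (hf : Continuous f) :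
    Tendsto (fun k => ∫ X, f X ∂(ρ k : Measure (Config d n))) l
      (𝓝 (∫ X, f X ∂(ν : Measure (Config d n)))) :=
  ((ProbabilityMeasure.continuous_integral_continuousMap (X := Config d n)
    (⟨f, hf⟩ : C(Config d n, ℝ))).tendsto ν).comp h

theorem measure_ext_of_integral {ν ν' : Measure (Config d n)} [IsFiniteMeasure ν]
    [IsFiniteMeasure ν'] (h : ∀ f : Config d n → ℝ, Continuous f →
      ∫ X, f X ∂ν = ∫ X, f X ∂ν') : ν = ν' :=
  ext_of_forall_integral_eq_of_IsFiniteMeasure fun f => h f f.continuous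

/-- A translation-invariant family of linear constraints that can be satisfied at all can be
satisfied by a translation-invariant measure. -/
theorem exists_isTranslationInvariant_integral_eq_zero {F : Set (Config d n → ℝ)}
    (hc : ∀ f ∈ F, Continuous f) (hs : ∀ f ∈ F, ∀ v, (fun X => f (translate v X)) ∈ F)
    {ν : ProbabilityMeasure (Config d n)}
    (hν : ∀ f ∈ F, ∫ X, f X ∂(ν : Measure (Config d n)) = 0) :
    ∃ ν' : ProbabilityMeasure (Config d n), IsTranslationInvariant ν' ∧
      ∀ f ∈ F, ∫ X, f X ∂(ν' : Measure (Config d n)) = 0 := by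
  -- Averaging preserves the constraints because F is stable under translations; shifting a box by v
  -- changes its average only by a boundary term, so the limit is invariant.
  obtain ⟨U, ν', hU, hlim⟩ := exists_ultrafilter_tendsto fun N => boxAverage N ν
  refine ⟨ν', fun v => ?_, fun f hf => ?_⟩
  · have := Measure.isProbabilityMeasure_map (μ := (ν' : Measure (Config d n)))
      (continuous_translate (n := n) v).measurable.aemeasurable
    refine measure_ext_of_integral fun f hf => ?_
    rw [integral_map (continuous_translate v).measurable.aemeasurable hf.aestronglyMeasurable]
    have hfv := hf.comp (continuous_translate (n := n) v)
    have h1 := (tendsto_integral_of_tendsto hlim hfv).sub (tendsto_integral_of_tendsto hlim hf)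
    obtain ⟨M, hM⟩ := exists_abs_le_of_continuous hf
    obtain ⟨k, hk⟩ := exists_subset_box {v}
    have hk : v ∈ box d k := hk (Finset.mem_singleton_self v)
    have h2 : ∀ N, |∫ X, (f ∘ translate v) X ∂(boxAverage N ν : Measure (Config d n)) -
        ∫ X, f X ∂(boxAverage N ν : Measure (Config d n))| ≤
        2 * M * (((box d (N + k)).card : ℝ) / (box d N).card - 1) := by
      intro N
      have hpos : (0 : ℝ) < (box d N).card := by exact_mod_cast card_box_pos N
      rw [integral_boxAverage N ν hfv, integral_boxAverage N ν hf, ← mul_sub, abs_mul,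
        abs_of_pos (inv_pos.2 hpos)]
      have hg : ∀ a, |∫ X, f (translate a X) ∂(ν : Measure (Config d n))| ≤ M := fun a => by
        have := norm_integral_le_of_norm_le_const (μ := (ν : Measure (Config d n)))
          (f := fun X => f (translate a X)) (C := M) (Eventually.of_forall fun X => hM _)
        simpa using this
      have := abs_sum_box_shift_le hg (N := N) hk
      have htr : ∀ a X, (f ∘ translate v) (translate a X) = f (translate (a + v) X) := fun a X => by
        refine congrArg f (funext fun b => ?_)
        simp only [translate, add_assoc, add_comm v a]
      simp only [htr]
      calc _ ≤ ((box d N).card : ℝ)⁻¹ * (2 * M * ((box d (N + k)).card - (box d N).card)) :=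
            mul_le_mul_of_nonneg_left this (inv_pos.2 hpos).le
        _ = _ := by field_simp
    have h3 : Tendsto (fun N => 2 * M * (((box d (N + k)).card : ℝ) / (box d N).card - 1)) U
        (𝓝 0) := by
      have := ((tendsto_card_box_ratio (d := d) k).sub_const 1).const_mul (2 * M)
      simp only [sub_self, mul_zero] at this
      exact this.mono_left hU
    exact sub_eq_zero.1 (tendsto_nhds_unique h1 (squeeze_zero_norm h2 h3))
  · have h1 := tendsto_integral_of_tendsto hlim (hc f hf)
    have h2 : ∀ N, ∫ X, f X ∂(boxAverage N ν : Measure (Config d n)) = 0 := fun N => by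
      rw [integral_boxAverage N ν (hc f hf),
        Finset.sum_eq_zero fun a _ => hν _ (hs f hf a), mul_zero]
    simp only [h2] at h1
    exact tendsto_nhds_unique h1 tendsto_const_nhds

/-! ### Existence of translation-invariant equilibrium states -/

theorem relEnergy_translate (Φ : Interaction d n) {Y X : Config d n} (h : IsLocalExcitation Y X)
    (v : Site d) : relEnergy Φ (translate v Y) (translate v X) = relEnergy Φ Y X := by
  obtain ⟨R, hR⟩ := exists_hasRange Φ
  obtain ⟨Λ, hΛ⟩ := h.exists_agreeOff R
  have hΛ' : AgreeOff (Λ.map (addRightEmbedding (-v))) R (translate v Y) (translate v X) := by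
    intro a ha w hw
    have ha' : a + v ∉ Λ := fun h => ha (Finset.mem_map.2 ⟨a + v, h, by simp⟩)
    have := hΛ _ ha' w hw
    simpa only [translate, add_right_comm a v w] using this
  rw [relEnergy_eq_sum hR hΛ, relEnergy_eq_sum hR hΛ', Finset.sum_map]
  refine Finset.sum_congr rfl fun a _ => ?_
  simp only [siteEnergy_translate, addRightEmbedding_apply, neg_add_cancel_right]

/-- The expectation of `f` in the grand-canonical ensemble with boundary condition `ω`. -/
def gibbsAverage (Φ : Interaction d n) (β : ℝ) (Λ : Finset (Site d)) (f : Config d n → ℝ)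
    (ω : Config d n) : ℝ :=
  ∑ ξ, gibbsProb Φ β Λ ω ξ * f (glue Λ ξ ω)

theorem continuous_gibbsAverage (Φ : Interaction d n) (β : ℝ) (Λ : Finset (Site d))
    {f : Config d n → ℝ} (hf : Continuous f) : Continuous (gibbsAverage Φ β Λ f) :=
  continuous_finsetSum _ fun ξ _ =>
    (continuous_gibbsProb Φ β Λ ξ).mul (hf.comp (continuous_glue Λ ξ))

/-- Covariance of the Gibbs specification; it makes the DLR constraints a translation-stable family.
-/
theorem gibbsAverage_translate (Φ : Interaction d n) (β : ℝ) (Λ : Finset (Site d))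
    (f : Config d n → ℝ) (v : Site d) (X : Config d n) :
    gibbsAverage Φ β Λ f (translate v X) =
      gibbsAverage Φ β (Λ.map (addRightEmbedding v)) (fun Y => f (translate v Y)) X := by
  let e : Λ ≃ (Λ.map (addRightEmbedding v) : Finset (Site d)) :=
    { toFun := fun a => ⟨a + v, Finset.mem_map.2 ⟨a, a.2, rfl⟩⟩
      invFun := fun a => ⟨a - v, by
        obtain ⟨b, hb, hba⟩ := Finset.mem_map.1 a.2
        rw [← hba]
        simpa using hb⟩
      left_inv := fun a => by simp
      right_inv := fun a => by simp }
  have hglue : ∀ ξ : Λ → Fin n, translate v (glue (Λ.map (addRightEmbedding v))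
      (Equiv.arrowCongr e (Equiv.refl _) ξ) X) = glue Λ ξ (translate v X) := by
    intro ξ
    funext a
    by_cases ha : a ∈ Λ
    · have hav : a + v ∈ Λ.map (addRightEmbedding v) := Finset.mem_map_of_mem _ ha
      rw [glue_apply_of_mem ha, translate, glue_apply_of_mem hav]
      simp [e]
    · rw [glue_apply_of_notMem ha, translate, glue_apply_of_notMem]
      · rfl
      · intro h
        obtain ⟨b, hb, hba⟩ := Finset.mem_map.1 h
        exact ha (add_right_cancel hba ▸ hb)
  have hw : ∀ ξ : Λ → Fin n, boltzmannWeight Φ β (Λ.map (addRightEmbedding v)) X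
      (Equiv.arrowCongr e (Equiv.refl _) ξ) = boltzmannWeight Φ β Λ (translate v X) ξ := by
    intro ξ
    rw [boltzmannWeight, boltzmannWeight, ← hglue,
      relEnergy_translate _ (isLocalExcitation_glue _ _ _)]
  unfold gibbsAverage gibbsProb
  rw [← Equiv.sum_comp (Equiv.arrowCongr e (Equiv.refl (Fin n))),
    ← Equiv.sum_comp (Equiv.arrowCongr e (Equiv.refl (Fin n)))
      (fun η => boltzmannWeight Φ β (Λ.map (addRightEmbedding v)) X η)]
  simp only [hw, hglue]

/-! ### Consistency of the finite-volume ensembles and the DLR equations. -/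

/-- Overwrite a pattern on a subregion. -/
def overwrite {Λ Λ' : Finset (Site d)} (ξ : Λ' → Fin n) (η : Λ → Fin n) : Λ' → Fin n :=
  fun a => if h : (a : Site d) ∈ Λ then η ⟨a, h⟩ else ξ a

theorem glue_glue {Λ Λ' : Finset (Site d)} (hΛ : Λ ⊆ Λ') (ξ : Λ' → Fin n) (η : Λ → Fin n)
    (ω : Config d n) : glue Λ η (glue Λ' ξ ω) = glue Λ' (overwrite ξ η) ω := by
  funext a
  by_cases ha : a ∈ Λ
  · rw [glue_apply_of_mem ha, glue_apply_of_mem (hΛ ha), overwrite, dif_pos ha]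
  · rw [glue_apply_of_notMem ha]
    by_cases ha' : a ∈ Λ'
    · rw [glue_apply_of_mem ha', glue_apply_of_mem ha', overwrite, dif_neg ha]
    · rw [glue_apply_of_notMem ha', glue_apply_of_notMem ha']

theorem overwrite_overwrite {Λ Λ' : Finset (Site d)} (ξ : Λ' → Fin n) (η η' : Λ → Fin n) :
    overwrite (overwrite ξ η) η' = overwrite ξ η' := by
  funext a
  by_cases ha : (a : Site d) ∈ Λ <;> simp [overwrite, ha]

theorem overwrite_restrict {Λ Λ' : Finset (Site d)} (hΛ : Λ ⊆ Λ') (ξ : Λ' → Fin n) :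
    overwrite ξ (fun a : Λ => ξ ⟨a, hΛ a.2⟩) = ξ := by
  funext a
  by_cases ha : (a : Site d) ∈ Λ <;> simp [overwrite, ha]

/-- Exchange the values of two patterns on the smaller of their regions. -/
def exchange {Λ Λ' : Finset (Site d)} (hΛ : Λ ⊆ Λ') :
    Equiv.Perm ((Λ' → Fin n) × (Λ → Fin n)) :=
  Function.Involutive.toPerm
    (fun p => (overwrite p.1 p.2, fun a => p.1 ⟨a, hΛ a.2⟩)) fun p => by
      refine Prod.ext ?_ ?_
      · simp only [overwrite_overwrite, overwrite_restrict]
      · funext a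
        simp [overwrite]

/-- Changing the reference configuration from `glue Λ' ξ ω` to ω multiplies all weights in Λ by a
factor independent of η, which cancels on normalization. -/
theorem gibbsProb_glue (Φ : Interaction d n) (β : ℝ) {Λ Λ' : Finset (Site d)} (hΛ : Λ ⊆ Λ')
    (ω : Config d n) (ξ : Λ' → Fin n) (η : Λ → Fin n) :
    gibbsProb Φ β Λ (glue Λ' ξ ω) η = boltzmannWeight Φ β Λ' ω (overwrite ξ η) /
      ∑ η' : Λ → Fin n, boltzmannWeight Φ β Λ' ω (overwrite ξ η') := by
  have h : ∀ η : Λ → Fin n, boltzmannWeight Φ β Λ (glue Λ' ξ ω) η =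
      boltzmannWeight Φ β Λ' ω (overwrite ξ η) / boltzmannWeight Φ β Λ' ω ξ := by
    intro η
    rw [boltzmannWeight, boltzmannWeight, boltzmannWeight, glue_glue hΛ,
      relEnergy_sub (isLocalExcitation_glue _ _ _) (isLocalExcitation_glue _ _ _),
      ← Real.exp_sub]
    congr 1
    ring
  unfold gibbsProb
  simp only [h, ← Finset.sum_div]
  exact div_div_div_cancel_right₀ (boltzmannWeight_pos _ _ _ _ _).ne' _ _

/-- Resampling inside Λ leaves the ensemble in Λ' invariant. This is reversibility: exchanging the
old and the new contents of Λ permutes the terms of the double sum. -/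
theorem gibbsAverage_gibbsAverage (Φ : Interaction d n) (β : ℝ) {Λ Λ' : Finset (Site d)}
    (hΛ : Λ ⊆ Λ') (f : Config d n → ℝ) (ω : Config d n) :
    gibbsAverage Φ β Λ' (gibbsAverage Φ β Λ f) ω = gibbsAverage Φ β Λ' f ω := by
  set W := boltzmannWeight Φ β Λ' ω with hW
  set Z := ∑ η : Λ' → Fin n, W η with hZ
  let D : (Λ' → Fin n) → ℝ := fun ξ => ∑ η : Λ → Fin n, W (overwrite ξ η)
  have hD : ∀ ξ, 0 < D ξ := fun ξ =>
    Finset.sum_pos (fun _ _ => boltzmannWeight_pos _ _ _ _ _)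
      ⟨fun a => ξ ⟨a, hΛ a.2⟩, Finset.mem_univ _⟩
  calc gibbsAverage Φ β Λ' (gibbsAverage Φ β Λ f) ω
      = ∑ ξ : Λ' → Fin n, ∑ η : Λ → Fin n, W ξ / Z * (W (overwrite ξ η) / D ξ *
          f (glue Λ' (overwrite ξ η) ω)) := by
        simp only [gibbsAverage, Finset.mul_sum]
        refine Finset.sum_congr rfl fun ξ _ => Finset.sum_congr rfl fun η _ => ?_
        rw [gibbsProb_glue Φ β hΛ, glue_glue hΛ]
        rfl
    -- The normalization D depends only on the part of ξ outside Λ, so the exchange does not change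
    -- it.
    _ = ∑ ξ : Λ' → Fin n, ∑ η : Λ → Fin n, W (overwrite ξ η) / Z * (W ξ / D ξ *
          f (glue Λ' ξ ω)) := by
        rw [← Fintype.sum_prod_type', ← Fintype.sum_prod_type', ← Equiv.sum_comp (exchange hΛ)]
        refine Finset.sum_congr rfl fun p _ => ?_
        have hp : exchange hΛ p = (overwrite p.1 p.2, fun a : Λ => p.1 ⟨a, hΛ a.2⟩) := rfl
        simp only [hp, overwrite_overwrite, overwrite_restrict, D]
    _ = gibbsAverage Φ β Λ' f ω := by
        refine Finset.sum_congr rfl fun ξ _ => ?_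
        rw [← Finset.sum_mul, ← Finset.sum_div]
        change D ξ / Z * (W ξ / D ξ * f (glue Λ' ξ ω)) = W ξ / Z * f (glue Λ' ξ ω)
        have := (hD ξ).ne'
        field_simp

instance (Φ : Interaction d n) (β : ℝ) (Λ : Finset (Site d)) (ω : Config d n) :
    IsProbabilityMeasure (finiteVolumeGibbs Φ β Λ ω) := ⟨by
  rw [finiteVolumeGibbs_apply _ _ _ _ MeasurableSet.univ]
  simp only [Set.indicator_univ, Pi.one_apply, mul_one]
  rw [← ENNReal.ofReal_sum_of_nonneg fun ξ _ => gibbsProb_nonneg _ _ _ _ _, sum_gibbsProb,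
    ENNReal.ofReal_one]⟩

theorem integral_finiteVolumeGibbs (Φ : Interaction d n) (β : ℝ) (Λ : Finset (Site d))
    (ω : Config d n) {f : Config d n → ℝ} (hf : Continuous f) :
    ∫ X, f X ∂(finiteVolumeGibbs Φ β Λ ω) = gibbsAverage Φ β Λ f ω := by
  unfold finiteVolumeGibbs
  rw [integral_finsetSum_measure]
  · refine Finset.sum_congr rfl fun ξ _ => ?_
    rw [integral_smul_measure, integral_dirac' _ _ hf.stronglyMeasurable, smul_eq_mul]
    exact congrArg (· * f (glue Λ ξ ω)) (ENNReal.toReal_ofReal (gibbsProb_nonneg Φ β Λ ω ξ))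
  · intro ξ _
    exact (integrable_of_continuous hf _).smul_measure ENNReal.ofReal_ne_top

/-- The Dobrushin-Lanford-Ruelle equations follow from their form for continuous observables. -/
theorem measure_eq_lintegral_finiteVolumeGibbs {Φ : Interaction d n} {β : ℝ}
    {Λ : Finset (Site d)} {ν : Measure (Config d n)} [IsFiniteMeasure ν]
    (h : ∀ f : Config d n → ℝ, Continuous f → ∫ X, (f X - gibbsAverage Φ β Λ f X) ∂ν = 0)
    {A : Set (Config d n)} (hA : MeasurableSet A) :
    ν A = ∫⁻ ω, finiteVolumeGibbs Φ β Λ ω A ∂ν := by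
  let κ : (Λ → Fin n) → Measure (Config d n) := fun ξ =>
    ν.withDensity fun ω => ENNReal.ofReal (gibbsProb Φ β Λ ω ξ)
  have hp : ∀ ξ : Λ → Fin n, Measurable fun ω => ENNReal.ofReal (gibbsProb Φ β Λ ω ξ) := fun ξ =>
    (continuous_gibbsProb Φ β Λ ξ).measurable.ennreal_ofReal
  have hg : ∀ ξ : Λ → Fin n, Measurable (glue Λ ξ : Config d n → Config d n) := fun ξ =>
    (continuous_glue Λ ξ).measurable
  have hκ : ∀ ξ, IsFiniteMeasure (κ ξ) := fun ξ =>
    isFiniteMeasure_withDensity_ofReal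
      (integrable_of_continuous (continuous_gibbsProb Φ β Λ ξ) ν).hasFiniteIntegral
  have hκm : ∀ ξ, IsFiniteMeasure (Measure.map (glue Λ ξ) (κ ξ)) := fun ξ =>
    Measure.isFiniteMeasure_map _ _
  -- The DLR equation as an identity of measures: ν is the sum over fillings ξ of its own image
  -- under gluing ξ, weighted by the probability of ξ.
  have heq : ν = ∑ ξ, Measure.map (glue Λ ξ) (κ ξ) := by
    refine measure_ext_of_integral fun f hf => ?_
    have h0 := h f hf
    rw [integral_sub (integrable_of_continuous hf ν)
      (integrable_of_continuous (continuous_gibbsAverage Φ β Λ hf) ν), sub_eq_zero] at h0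
    rw [h0, integral_finsetSum_measure fun ξ _ => integrable_of_continuous hf _]
    unfold gibbsAverage
    rw [integral_finsetSum]
    · refine Finset.sum_congr rfl fun ξ _ => ?_
      rw [integral_map (hg ξ).aemeasurable hf.aestronglyMeasurable]
      simp only [κ]
      rw [integral_withDensity_eq_integral_toReal_smul (hp ξ) (by simp)]
      refine integral_congr_ae (Eventually.of_forall fun ω => ?_)
      simp only [ENNReal.toReal_ofReal (gibbsProb_nonneg Φ β Λ ω ξ), smul_eq_mul]
    · intro ξ _
      exact integrable_of_continuous
        ((continuous_gibbsProb Φ β Λ ξ).mul (hf.comp (continuous_glue Λ ξ))) ν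
  conv_lhs => rw [heq]
  simp only [finiteVolumeGibbs_apply _ _ _ _ hA, Measure.coe_finsetSum, Finset.sum_apply]
  rw [lintegral_finsetSum]
  · refine Finset.sum_congr rfl fun ξ _ => ?_
    rw [Measure.map_apply (hg ξ) hA, withDensity_apply _ (hg ξ hA),
      ← lintegral_indicator (hg ξ hA)]
    refine lintegral_congr fun ω => ?_
    by_cases hω : glue Λ ξ ω ∈ A
    · rw [Set.indicator_of_mem hω, Set.indicator_of_mem (show ω ∈ glue Λ ξ ⁻¹' A from hω)]
      simp
    · rw [Set.indicator_of_notMem hω, Set.indicator_of_notMem (show ω ∉ glue Λ ξ ⁻¹' A from hω)]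
      simp
  · intro ξ _
    exact (hp ξ).mul ((measurable_one.indicator hA).comp (hg ξ))

/-- The DLR equations are linear constraints ∫ (f − `gibbsAverage` f) = 0. A limit of finite-volume
ensembles satisfies them all, and averaging over translations then gives an invariant solution. -/
theorem exists_isEquilibriumState (Φ : Interaction d n) (β : ℝ) (ω : Config d n) :
    ∃ ρ, IsEquilibriumState Φ β ρ := by
  let κ : ℕ → ProbabilityMeasure (Config d n) := fun N =>
    ⟨finiteVolumeGibbs Φ β (box d N) ω, inferInstance⟩
  obtain ⟨U, ν, hU, hlim⟩ := exists_ultrafilter_tendsto κ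
  let F : Set (Config d n → ℝ) :=
    {g | ∃ (Λ : Finset (Site d)) (f : Config d n → ℝ), Continuous f ∧
      g = fun X => f X - gibbsAverage Φ β Λ f X}
  have hc : ∀ g ∈ F, Continuous g := by
    rintro _ ⟨Λ, f, hf, rfl⟩
    exact hf.sub (continuous_gibbsAverage Φ β Λ hf)
  have hs : ∀ g ∈ F, ∀ v, (fun X => g (translate v X)) ∈ F := by
    rintro _ ⟨Λ, f, hf, rfl⟩ v
    refine ⟨Λ.map (addRightEmbedding v), fun X => f (translate v X),
      hf.comp (continuous_translate v), ?_⟩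
    funext X
    exact congrArg (f (translate v X) - ·) (gibbsAverage_translate Φ β Λ f v X)
  have hν : ∀ g ∈ F, ∫ X, g X ∂(ν : Measure (Config d n)) = 0 := by
    rintro _ ⟨Λ, f, hf, rfl⟩
    obtain ⟨M, hM⟩ := exists_subset_box Λ
    have hcont := hf.sub (continuous_gibbsAverage Φ β Λ hf)
    refine tendsto_nhds_unique (tendsto_integral_of_tendsto hlim hcont)
      (tendsto_const_nhds.congr' (hU ?_))
    -- Once the box contains Λ, consistency makes the constraint hold exactly, before any limit.
    filter_upwards [eventually_ge_atTop M] with N hN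
    change 0 = ∫ X, (f X - gibbsAverage Φ β Λ f X) ∂(finiteVolumeGibbs Φ β (box d N) ω)
    rw [integral_sub (integrable_of_continuous hf _)
      (integrable_of_continuous (continuous_gibbsAverage Φ β Λ hf) _),
      integral_finiteVolumeGibbs _ _ _ _ hf,
      integral_finiteVolumeGibbs _ _ _ _ (continuous_gibbsAverage Φ β Λ hf),
      gibbsAverage_gibbsAverage _ _ (hM.trans (box_mono hN)), sub_self]
  obtain ⟨ρ, hρ, hρF⟩ := exists_isTranslationInvariant_integral_eq_zero hc hs hν
  exact ⟨ρ, hρ, fun Λ A hA =>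
    measure_eq_lintegral_finiteVolumeGibbs (fun f hf => hρF _ ⟨Λ, f, hf, rfl⟩) hA⟩

theorem exists_isGroundState (Φ : Interaction d n) (ω : Config d n) :
    ∃ ν, IsGroundState Φ ν := by
  choose ρ hρ using fun k : ℕ => exists_isEquilibriumState Φ k ω
  obtain ⟨ν, φ, hφ, hlim⟩ := CompactSpace.tendsto_subseq ρ
  exact ⟨ν, fun k => (φ k : ℝ), ρ ∘ φ, tendsto_natCast_atTop_atTop.comp hφ.tendsto_atTop,
    fun k => hρ (φ k), hlim⟩

/-- Every ground state must be μ; that μ is itself one follows because some ground state exists. -/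
theorem HasUniqueGroundStateMeasure.hasUniqueGroundState {Φ : Interaction d n}
    {μ : ProbabilityMeasure (Config d n)} (h : HasUniqueGroundStateMeasure Φ μ) :
    HasUniqueGroundState Φ μ := by
  obtain ⟨ω⟩ := μ.nonempty
  obtain ⟨ν₀, hν₀⟩ := exists_isGroundState Φ ω
  intro ν
  refine ⟨fun hν => (h ν).1 hν.isGroundStateMeasure, ?_⟩
  rintro rfl
  rwa [← (h ν₀).1 hν₀.isGroundStateMeasure]

/-! ### Nontrivial excitations of the ground state break bonds -/

/-- The maps θ ↦ exp(θ·a) for distinct sites a are distinct characters of the additive group ℝ^d,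
hence linearly independent. -/
theorem exists_sum_mul_exp_ne_zero {s : Finset (Site d)} {c : Site d → ℝ}
    (h : ∃ a ∈ s, c a ≠ 0) :
    ∃ θ : Fin d → ℝ, ∑ a ∈ s, c a * Real.exp (∑ i, θ i * (a i : ℝ)) ≠ 0 := by
  by_contra! hzero
  let χ : Site d → Multiplicative (Fin d → ℝ) →* ℝ := fun a =>
    { toFun := fun θ => Real.exp (∑ i, θ.toAdd i * (a i : ℝ))
      map_one' := by simp
      map_mul' := fun x y => by
        simp [add_mul, Finset.sum_add_distrib, Real.exp_add] }
  have hχ : Function.Injective χ := by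
    intro a b hab
    funext i
    have h1 := DFunLike.congr_fun hab (Multiplicative.ofAdd (Pi.single i (1 : ℝ)))
    have h2 : ∀ a : Site d, χ a (Multiplicative.ofAdd (Pi.single i (1 : ℝ))) =
        Real.exp (a i : ℝ) := fun a => by
      change Real.exp (∑ j, (Pi.single i (1 : ℝ) : Fin d → ℝ) j * (a j : ℝ)) = _
      simp [Pi.single_apply]
    rw [h2, h2] at h1
    exact_mod_cast Real.exp_injective h1
  have hli := (linearIndependent_monoidHom (Multiplicative (Fin d → ℝ)) ℝ).comp χ hχ
  obtain ⟨a, ha, hca⟩ := h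
  refine hca (linearIndependent_iff'.1 hli s c ?_ a ha)
  funext θ
  simpa [χ] using hzero θ.toAdd

/-- The Dirac measure at Z satisfies all the constraints; averaging it yields an invariant measure
that does too. -/
theorem exists_isTranslationInvariant_of_orbit {h : Config d n → ℝ} (hc : Continuous h)
    {Z : Config d n} (hZ : ∀ b, h (translate b Z) = 0) :
    ∃ ν : ProbabilityMeasure (Config d n), IsTranslationInvariant ν ∧
      ∀ b, ∫ X, h (translate b X) ∂(ν : Measure (Config d n)) = 0 := by
  obtain ⟨ν, hν, hF⟩ := exists_isTranslationInvariant_integral_eq_zero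
    (F := Set.range fun b X => h (translate b X))
    (ν := ⟨Measure.dirac Z, inferInstance⟩)
    (by rintro _ ⟨b, rfl⟩; exact hc.comp (continuous_translate b))
    (by
      rintro _ ⟨b, rfl⟩ v
      exact ⟨b + v, funext fun X => congrArg h (funext fun a =>
        congrArg X (add_assoc a b v).symm)⟩)
    (by
      rintro _ ⟨b, rfl⟩
      change ∫ X, h (translate b X) ∂(Measure.dirac Z) = 0
      exact (integral_dirac' _ _ (hc.comp (continuous_translate b)).stronglyMeasurable).trans
        (hZ b))
  exact ⟨ν, hν, fun b => hF _ ⟨b, rfl⟩⟩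

/-! ### Eliminating a pattern that can be replaced at no cost. -/

/-- The pattern of `X` on `box d K` occurs at the origin of `Z`. -/
def HasPattern (X : Config d n) (K : ℕ) (Z : Config d n) : Prop := ∀ a ∈ box d K, Z a = X a

/-- The indicator function of the occurrence of a pattern at the origin. -/
def patternIndicator (X : Config d n) (K : ℕ) (Z : Config d n) : ℝ :=
  ∏ a ∈ box d K, if Z a = X a then 1 else 0

theorem continuous_patternIndicator (X : Config d n) (K : ℕ) :
    Continuous (patternIndicator X K) :=
  continuous_finsetProd _ fun a _ =>
    (continuous_of_discreteTopology (f := fun s : Fin n => if s = X a then (1 : ℝ) else 0)).comp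
      (continuous_apply a)

theorem patternIndicator_nonneg (X : Config d n) (K : ℕ) (Z : Config d n) :
    0 ≤ patternIndicator X K Z :=
  Finset.prod_nonneg fun a _ => by split_ifs <;> norm_num

theorem patternIndicator_eq_zero_iff {X : Config d n} {K : ℕ} {Z : Config d n} :
    patternIndicator X K Z = 0 ↔ ¬ HasPattern X K Z := by
  simp [patternIndicator, HasPattern, Finset.prod_eq_zero_iff]

/-- Replace the part of `Z` near `b` by the part of `Y` near the origin. -/
def transplant (Y : Config d n) (M : ℕ) (b : Site d) (Z : Config d n) : Config d n :=
  fun a => if a - b ∈ box d M then Y (a - b) else Z a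

/-- A bond meeting the replaced cube stays inside the larger cube of the pattern, where the new
configuration is a translate of Y; any other bond is a bond of Z. The margin R covers the length of
a bond. -/
theorem brokenBonds_transplant_eq_empty {Φ : Interaction d n} {R M : ℕ} (hR : HasRange Φ R)
    {X Y Z : Config d n} (hXY : ∀ a ∉ box d M, Y a = X a) (hY : brokenBonds Φ Y = ∅)
    (hZ : brokenBonds Φ Z = ∅) {b : Site d} (hb : HasPattern X (M + R) (translate b Z)) :
    brokenBonds Φ (transplant Y M b Z) = ∅ := by
  rw [brokenBonds_eq_empty_iff] at *
  intro a v
  by_cases hv : v ∈ box d R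
  swap
  · exact hR v hv _ _
  have hin : ∀ c, c - b ∈ box d (M + R) → transplant Y M b Z c = Y (c - b) := by
    intro c hc
    by_cases hcM : c - b ∈ box d M
    · exact if_pos hcM
    · rw [transplant, if_neg hcM, hXY _ hcM, ← hb _ hc, translate, sub_add_cancel]
  have hout : ∀ c, c - b ∉ box d M → transplant Y M b Z c = Z c := fun c hc => if_neg hc
  by_cases h1 : a - b ∈ box d M
  · have h2 : a + v - b ∈ box d (M + R) := by
      rw [add_sub_right_comm]
      exact add_mem_box h1 hv
    rw [hin a (box_mono (Nat.le_add_right M R) h1), hin _ h2, add_sub_right_comm]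
    exact hY _ v
  · by_cases h2 : a + v - b ∈ box d M
    · have h3 : a - b ∈ box d (M + R) := by
        have := add_mem_box h2 (neg_mem_box hv)
        rwa [show a + v - b + -v = a - b by abel] at this
      rw [hin _ h3, hin _ (box_mono (Nat.le_add_right M R) h2), add_sub_right_comm]
      exact hY _ v
    · rw [hout _ h1, hout _ h2]
      exact hZ a v

/-- If a pattern can be replaced without breaking bonds, then there is a configuration without
broken bonds in which it never occurs: inside a large box, maximize a weighted particle count
which every replacement increases. -/
theorem exists_brokenBonds_eq_empty_forall_not_hasPattern {Φ : Interaction d n}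
    (hΦ : IsBondHamiltonian Φ) {R M : ℕ} (hR : HasRange Φ R) {X Y : Config d n}
    (hXY : ∀ a ∉ box d M, Y a = X a) (hne : Y ≠ X) (hX : brokenBonds Φ X = ∅)
    (hY : brokenBonds Φ Y = ∅) :
    ∃ Z, brokenBonds Φ Z = ∅ ∧ ∀ b, ¬ HasPattern X (M + R) (translate b Z) := by
  classical
  -- An unweighted count might not distinguish Y from X; a suitable exponential weight does, and it
  -- only acquires a positive factor under translation.
  obtain ⟨θ, hθ⟩ := exists_sum_mul_exp_ne_zero (s := box d M)
    (c := fun a => ((Y a : ℕ) : ℝ) - ((X a : ℕ) : ℝ)) (by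
      by_contra! hzero
      refine hne (funext fun a => ?_)
      by_cases ha : a ∈ box d M
      · have h1 := sub_eq_zero.1 (hzero a ha)
        exact Fin.ext (by exact_mod_cast h1)
      · exact hXY a ha)
  set g : Site d → ℝ := fun a => Real.exp (∑ i, θ i * (a i : ℝ)) with hg
  have hgadd : ∀ a b, g (a + b) = g b * g a := fun a b => by
    simp only [hg, ← Real.exp_add, Pi.add_apply, Int.cast_add, mul_add, Finset.sum_add_distrib,
      add_comm]
  set S := ∑ a ∈ box d M, (((Y a : ℕ) : ℝ) - ((X a : ℕ) : ℝ)) * g a with hS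
  -- With the prefactor S, a replacement at b changes G by g(b)S² > 0, whatever the sign of S.
  let G : ℕ → Config d n → ℝ := fun N Z => S * ∑ a ∈ box d N, ((Z a : ℕ) : ℝ) * g a
  have hGt : ∀ N Z b, b ∈ box d N → HasPattern X (M + R) (translate b Z) →
      G (N + M) Z < G (N + M) (transplant Y M b Z) := by
    intro N Z b hb hpat
    have hsub : (box d M).map (addRightEmbedding b) ⊆ box d (N + M) := fun a ha => by
      obtain ⟨c, hc, rfl⟩ := Finset.mem_map.1 ha
      rw [Nat.add_comm]
      exact add_mem_box hc hb
    have hdiff : ∑ a ∈ box d (N + M), ((transplant Y M b Z a : ℕ) : ℝ) * g a -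
        ∑ a ∈ box d (N + M), ((Z a : ℕ) : ℝ) * g a = g b * S := by
      rw [← Finset.sum_sub_distrib, ← Finset.sum_subset hsub, Finset.sum_map, hS, Finset.mul_sum]
      · refine Finset.sum_congr rfl fun a ha => ?_
        have h1 : transplant Y M b Z (a + b) = Y a := by simp [transplant, ha]
        have h2 : Z (a + b) = X a := hpat a (box_mono (Nat.le_add_right M R) ha)
        rw [addRightEmbedding_apply, h1, h2, hgadd]
        ring
      · intro a _ ha
        have h1 : a - b ∉ box d M := fun h => ha (Finset.mem_map.2 ⟨a - b, h, by simp⟩)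
        rw [transplant, if_neg h1, sub_self]
    have hpos : 0 < S * (g b * S) := by
      have h1 : 0 < g b := Real.exp_pos _
      have h2 : 0 < S * S := mul_self_pos.2 hθ
      nlinarith
    rw [← hdiff, mul_sub] at hpos
    exact sub_pos.1 hpos
  have hmax : ∀ N, ∃ Z, brokenBonds Φ Z = ∅ ∧
      ∀ b ∈ box d N, ¬ HasPattern X (M + R) (translate b Z) := by
    intro N
    -- The finitely many candidates agree with X outside the box, and X is one of them. At a
    -- maximizer of G no pattern centred in `box d N` can remain, as replacing it would give a
    -- better candidate.
    let T : Finset (box d (N + M) → Fin n) :=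
      Finset.univ.filter fun ξ => brokenBonds Φ (glue (box d (N + M)) ξ X) = ∅
    have hT : T.Nonempty := ⟨fun a => X a, by
      simp only [T, Finset.mem_filter, Finset.mem_univ, true_and]
      rwa [glue_restrict_eq fun _ _ => rfl]⟩
    obtain ⟨ξ, hξ, hξmax⟩ :=
      Finset.exists_max_image T (fun ξ => G (N + M) (glue (box d (N + M)) ξ X)) hT
    have hξ : brokenBonds Φ (glue (box d (N + M)) ξ X) = ∅ := (Finset.mem_filter.1 hξ).2
    refine ⟨_, hξ, fun b hb hpat => ?_⟩
    have hlt := hGt N _ b hb hpat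
    have hZ := brokenBonds_transplant_eq_empty hR hXY hY hξ hpat
    have heq : glue (box d (N + M))
        (fun a => transplant Y M b (glue (box d (N + M)) ξ X) a) X =
        transplant Y M b (glue (box d (N + M)) ξ X) := by
      refine glue_restrict_eq fun a ha => ?_
      have h1 : a - b ∉ box d M := fun h => ha (by
        have := add_mem_box h hb
        rwa [sub_add_cancel, Nat.add_comm] at this)
      rw [transplant, if_neg h1, glue_apply_of_notMem ha]
    rw [← heq] at hlt hZ
    exact absurd (hξmax _ (Finset.mem_filter.2 ⟨Finset.mem_univ _, hZ⟩)) (not_le.2 hlt)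
  choose Z hZ hZpat using hmax
  obtain ⟨U, Z', hU, hlim⟩ := exists_ultrafilter_tendsto Z
  refine ⟨Z', (isClosed_setOf_brokenBonds_eq_empty hΦ).mem_of_tendsto hlim
    (Eventually.of_forall hZ), fun b => ?_⟩
  obtain ⟨N, hN⟩ := exists_subset_box {b}
  have hN := hN (Finset.mem_singleton_self b)
  have hcont := (continuous_patternIndicator X (M + R)).comp (continuous_translate (n := n) b)
  rw [← patternIndicator_eq_zero_iff]
  refine tendsto_nhds_unique ((hcont.tendsto Z').comp hlim)
    (tendsto_const_nhds.congr' (hU ?_))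
  filter_upwards [eventually_ge_atTop N] with N' hN'
  exact (patternIndicator_eq_zero_iff.2 (hZpat N' b (box_mono hN' hN))).symm

theorem brokenBonds_eq_empty_of_mem_support {Φ : Interaction d n} (hΦ : IsBondHamiltonian Φ)
    {μ : ProbabilityMeasure (Config d n)}
    (hμ₀ : ∀ᵐ X ∂(μ : Measure (Config d n)), brokenBonds Φ X = ∅) {X : Config d n}
    (hX : X ∈ (μ : Measure (Config d n)).support) : brokenBonds Φ X = ∅ :=
  Measure.support_subset_of_isClosed (isClosed_setOf_brokenBonds_eq_empty hΦ) hμ₀ hX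

theorem ae_brokenBonds_eq_empty_of_integral_eq_zero {Φ : Interaction d n}
    (hΦ : IsBondHamiltonian Φ) {R : ℕ} (hR : HasRange Φ R) {ν : ProbabilityMeasure (Config d n)}
    (h : ∀ a, ∫ X, siteEnergy Φ R X a ∂(ν : Measure (Config d n)) = 0) :
    ∀ᵐ X ∂(ν : Measure (Config d n)), brokenBonds Φ X = ∅ := by
  simp only [brokenBonds_eq_empty_iff_siteEnergy hΦ hR]
  rw [ae_all_iff]
  intro a
  have := (integral_eq_zero_iff_of_nonneg (fun X => siteEnergy_nonneg hΦ R X a)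
    (integrable_of_continuous (continuous_siteEnergy Φ R a) _)).1 (h a)
  exact this

/-- If there is only one translation-invariant ground-state measure, then every nontrivial local
excitation of a configuration in its support has broken bonds. -/
theorem numBrokenBonds_pos {Φ : Interaction d n} (hΦ : IsBondHamiltonian Φ)
    {μ : ProbabilityMeasure (Config d n)} (hμ : HasUniqueGroundStateMeasure Φ μ)
    (hμ₀ : ∀ᵐ X ∂(μ : Measure (Config d n)), brokenBonds Φ X = ∅) {X Y : Config d n}
    (hX : X ∈ (μ : Measure (Config d n)).support) (hYX : IsLocalExcitation Y X) (hne : Y ≠ X) :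
    0 < numBrokenBonds Φ Y := by
  by_contra! hB
  obtain ⟨R, hR⟩ := exists_hasRange Φ
  obtain ⟨M, hM⟩ := hYX.exists_box
  have hX₀ := brokenBonds_eq_empty_of_mem_support hΦ hμ₀ hX
  have hY₀ : brokenBonds Φ Y = ∅ := by
    rw [brokenBonds_eq_empty_iff_siteEnergy hΦ hR] at hX₀ ⊢
    have hoff : ∀ a ∉ box d (M + R), siteEnergy Φ R Y a = 0 := fun a ha => by
      rw [siteEnergy_congr (agreeOff_box hM a ha), hX₀]
    have hsum := numBrokenBonds_eq_sum hΦ hR hoff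
    rw [Nat.le_zero.1 hB, Nat.cast_zero, eq_comm,
      Finset.sum_eq_zero_iff_of_nonneg fun a _ => siteEnergy_nonneg hΦ R Y a] at hsum
    intro a
    by_cases ha : a ∈ box d (M + R)
    · exact hsum a ha
    · exact hoff a ha
  obtain ⟨Z, hZ, hZpat⟩ :=
    exists_brokenBonds_eq_empty_forall_not_hasPattern hΦ hR hM hne hX₀ hY₀
  have hZ₀ := (brokenBonds_eq_empty_iff_siteEnergy hΦ hR).1 hZ
  have hce := continuous_siteEnergy Φ R (0 : Site d)
  have hcp := continuous_patternIndicator X (M + R)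
  -- Both summands are nonnegative, so a vanishing integral of the sum makes each integral vanish: ν
  -- has no broken bonds and no occurrence of the pattern. Uniqueness gives ν = μ, but X in the
  -- support gives the pattern positive probability.
  obtain ⟨ν, hν, hint⟩ := exists_isTranslationInvariant_of_orbit
    (h := fun Z => siteEnergy Φ R Z 0 + patternIndicator X (M + R) Z) (hce.add hcp) (Z := Z)
    fun b => by
      rw [siteEnergy_translate, hZ₀, patternIndicator_eq_zero_iff.2 (hZpat b), add_zero]
  have hsplit : ∀ b, ∫ X, siteEnergy Φ R X b ∂(ν : Measure (Config d n)) = 0 ∧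
      ∫ Z, patternIndicator X (M + R) (translate b Z) ∂(ν : Measure (Config d n)) = 0 := by
    intro b
    have h1 := hint b
    simp only [siteEnergy_translate, zero_add] at h1
    have hcb : Continuous fun Z => patternIndicator X (M + R) (translate b Z) :=
      hcp.comp (continuous_translate b)
    rw [integral_add (integrable_of_continuous (continuous_siteEnergy Φ R b) _)
      (integrable_of_continuous hcb _)] at h1
    have h2 : 0 ≤ ∫ X, siteEnergy Φ R X b ∂(ν : Measure (Config d n)) :=
      integral_nonneg fun X => siteEnergy_nonneg hΦ R X b
    have h3 : 0 ≤ ∫ Z, patternIndicator X (M + R) (translate b Z) ∂(ν : Measure (Config d n)) :=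
      integral_nonneg fun Z => patternIndicator_nonneg _ _ _
    constructor <;> linarith
  have hνμ : ν = μ := (hμ ν).1 ⟨hν,
    (ae_brokenBonds_eq_empty_of_integral_eq_zero hΦ hR fun a => (hsplit a).1).mono
      fun X hX => isGroundStateConfig_of_brokenBonds_eq_empty hΦ hX⟩
  have h0 := (hsplit 0).2
  have htr : ∀ Z : Config d n, translate 0 Z = Z := fun Z => funext fun a => by simp [translate]
  simp only [htr, hνμ] at h0
  have hae := (integral_eq_zero_iff_of_nonneg (patternIndicator_nonneg X (M + R))
    (integrable_of_continuous hcp _)).1 h0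
  have hopen : IsOpen {Z | patternIndicator X (M + R) Z ≠ 0} := isOpen_ne_fun hcp continuous_const
  have hpos := (Measure.mem_support_iff_forall X).1 hX _ (hopen.mem_nhds (by
    rw [Set.mem_ofPred_eq, Ne, patternIndicator_eq_zero_iff, not_not]
    exact fun _ _ => rfl))
  exact hpos.ne' (ae_iff.1 hae)

/-! ### The strict boundary condition implies stability -/

theorem IsSmallPerturbation.hasRange {r ε : ℝ} {Ψ : Interaction d n}
    (h : IsSmallPerturbation r ε Ψ) {N : ℕ} (hN : r ≤ N) : HasRange Ψ N := fun v hv s t => by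
  refine h.1 v ?_ s t
  by_contra! hlt
  exact hv (mem_box_of_siteNorm_le (hlt.le.trans hN))

theorem countDiff_self (ar : Arrangement d n) (X : Config d n) : ar.countDiff X X = 0 := by
  simp [Arrangement.countDiff]

/-- The relative energy of Ψ is linear in the counts of finitely many arrangements, and the boundary
conditions bound these by multiples of B(Y). The constant K collects the multiples and does not
depend on Ψ. -/
theorem exists_abs_relEnergy_le {Φ : Interaction d n} {μ : ProbabilityMeasure (Config d n)} {r : ℝ}
    (h : ∀ ar : Arrangement d n, ar.HasRangeLT r → StrictBoundaryCondition Φ μ ar) :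
    ∃ K : ℝ, 0 ≤ K ∧ ∀ ε Ψ, IsSmallPerturbation r ε Ψ →
      ∀ X ∈ (μ : Measure (Config d n)).support, ∀ Y, IsLocalExcitation Y X →
        |relEnergy Ψ Y X| ≤ ε * K * numBrokenBonds Φ Y := by
  classical
  choose C hC0 hC using h
  -- The value 0 for arrangements out of range is harmless, since Ψ gives them no energy.
  let C' : Arrangement d n → ℝ := fun ar => if h : ar.HasRangeLT r then C ar h else 0
  have hC' : ∀ ar, 0 ≤ C' ar := fun ar => by
    by_cases h : ar.HasRangeLT r
    · simp only [C', dif_pos h]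
      exact (hC0 ar h).le
    · simp only [C', dif_neg h, le_refl]
  have hbound : ∀ ar, ar.HasRangeLT r → ∀ X ∈ (μ : Measure (Config d n)).support,
      ∀ Y, IsLocalExcitation Y X →
        |(ar.countDiff Y X : ℝ)| ≤ C' ar * numBrokenBonds Φ Y := by
    intro ar har X hX Y hY
    by_cases hne : Y = X
    · subst hne
      rw [countDiff_self, Int.cast_zero, abs_zero]
      exact mul_nonneg (hC' ar) (Nat.cast_nonneg _)
    · simp only [C', dif_pos har]
      exact (hC ar har X hX Y hY hne).le
  obtain ⟨N, hN⟩ := exists_nat_ge r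
  refine ⟨∑ s, C' (.particle s) + 1 / 2 * ∑ v ∈ box d N, ∑ s, ∑ t, C' (.pair v s t), ?_, ?_⟩
  · exact add_nonneg (Finset.sum_nonneg fun s _ => hC' _) (mul_nonneg (by norm_num)
      (Finset.sum_nonneg fun v _ => Finset.sum_nonneg fun s _ => Finset.sum_nonneg fun t _ =>
        hC' _))
  intro ε Ψ hΨ X hX Y hY
  rw [relEnergy_eq_countDiff (hΨ.hasRange hN) hY]
  set B : ℝ := (numBrokenBonds Φ Y : ℝ)
  have hB : 0 ≤ B := Nat.cast_nonneg _
  have h1 : |∑ s, Ψ.one s * ((Arrangement.particle s : Arrangement d n).countDiff Y X : ℝ)| ≤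
      ∑ s, ε * (C' (.particle s) * B) := by
    refine (Finset.abs_sum_le_sum_abs _ _).trans (Finset.sum_le_sum fun s _ => ?_)
    rw [abs_mul]
    exact mul_le_mul (hΨ.2.1 s).le (hbound (.particle s) trivial X hX Y hY) (abs_nonneg _)
      ((abs_nonneg _).trans (hΨ.2.1 s).le)
  have h2 : |∑ v ∈ box d N, ∑ s, ∑ t,
      Ψ.two v s t * ((Arrangement.pair v s t : Arrangement d n).countDiff Y X : ℝ)| ≤
      ∑ v ∈ box d N, ∑ s, ∑ t, ε * (C' (.pair v s t) * B) := by
    refine (Finset.abs_sum_le_sum_abs _ _).trans (Finset.sum_le_sum fun v _ =>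
      (Finset.abs_sum_le_sum_abs _ _).trans (Finset.sum_le_sum fun s _ =>
        (Finset.abs_sum_le_sum_abs _ _).trans (Finset.sum_le_sum fun t _ => ?_)))
    have hε : 0 ≤ ε := (abs_nonneg _).trans (hΨ.2.2 v s t).le
    by_cases hv : v ≠ 0 ∧ siteNorm v < r
    · rw [abs_mul]
      exact mul_le_mul (hΨ.2.2 v s t).le (hbound (.pair v s t) hv X hX Y hY) (abs_nonneg _) hε
    · have hzero : Ψ.two v s t = 0 := by
        rw [not_and_or, not_not, not_lt] at hv
        rcases hv with rfl | hv
        · exact Ψ.two_zero s t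
        · exact hΨ.1 v hv s t
      rw [hzero, zero_mul, abs_zero]
      exact mul_nonneg hε (mul_nonneg (hC' _) hB)
  simp only [← Finset.mul_sum, ← Finset.sum_mul] at h1 h2
  calc _ ≤ ε * ((∑ s, C' (.particle s)) * B) +
        1 / 2 * (ε * ((∑ v ∈ box d N, ∑ s, ∑ t, C' (.pair v s t)) * B)) := by
        refine (abs_add_le _ _).trans (add_le_add h1 ?_)
        rw [abs_mul, abs_of_nonneg (by norm_num : (0 : ℝ) ≤ 1 / 2)]
        exact mul_le_mul_of_nonneg_left h2 (by norm_num)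
    _ = _ := by ring

/-- `X` inside the region, `X'` outside. -/
def patch (Λ : Finset (Site d)) (X X' : Config d n) : Config d n :=
  fun a => if a ∈ Λ then X a else X' a

theorem patch_of_mem {Λ : Finset (Site d)} {X X' : Config d n} {a : Site d} (h : a ∈ Λ) :
    patch Λ X X' a = X a := if_pos h

theorem patch_of_notMem {Λ : Finset (Site d)} {X X' : Config d n} {a : Site d} (h : a ∉ Λ) :
    patch Λ X X' a = X' a := if_neg h

theorem isLocalExcitation_patch (Λ : Finset (Site d)) (X X' : Config d n) :
    IsLocalExcitation (patch Λ X X') X' :=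
  isLocalExcitation_of_eqOff fun _ h => patch_of_notMem h

theorem siteEnergy_patch (Φ : Interaction d n) {N R : ℕ} (X X' : Config d n) {a : Site d}
    (ha : a ∈ box d N) :
    siteEnergy Φ R (patch (box d (N + R)) X X') a = siteEnergy Φ R X a :=
  siteEnergy_congr fun _ hv => patch_of_mem (add_mem_box ha hv)

theorem exists_abs_siteEnergy_le (Φ : Interaction d n) (R : ℕ) :
    ∃ M, ∀ X a, |siteEnergy Φ R X a| ≤ M := by
  obtain ⟨M, hM⟩ := exists_abs_le_of_continuous (continuous_siteEnergy (n := n) Φ R 0)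
  refine ⟨M, fun X a => ?_⟩
  have := hM (translate a X)
  rwa [siteEnergy_translate, zero_add] at this

/-- Exchanging two configurations in a box costs only a boundary term. -/
theorem relEnergy_patch_add_le {Φ : Interaction d n} {R : ℕ} (hR : HasRange Φ R) {M : ℝ}
    (hM : ∀ X a, |siteEnergy Φ R X a| ≤ M) (X X' : Config d n) (N : ℕ) :
    relEnergy Φ (patch (box d (N + R)) X' X) X + relEnergy Φ (patch (box d (N + R)) X X') X' ≤
      4 * M * ((box d (N + (R + R))).card - (box d N).card) := by
  have hag : ∀ X X' : Config d n,
      AgreeOff (box d (N + (R + R))) R (patch (box d (N + R)) X' X) X := fun X X' => by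
    rw [← Nat.add_assoc]
    exact agreeOff_box fun a ha => patch_of_notMem ha
  have hsub : box d N ⊆ box d (N + (R + R)) := box_mono (Nat.le_add_right _ _)
  -- Inside `box d N` the two exchanges cancel. What remains is the layer of width 2R, where four
  -- site energies, each at most M in absolute value, occur per site.
  rw [relEnergy_eq_sum hR (hag X X'), relEnergy_eq_sum hR (hag X' X), ← Finset.sum_add_distrib,
    ← Finset.sum_sdiff hsub, Finset.sum_eq_zero (s := box d N), add_zero]
  · refine (Finset.sum_le_card_nsmul _ _ (4 * M) fun a _ => ?_).trans (le_of_eq ?_)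
    · have h1 := abs_le.1 (hM (patch (box d (N + R)) X' X) a)
      have h2 := abs_le.1 (hM (patch (box d (N + R)) X X') a)
      have h3 := abs_le.1 (hM X a)
      have h4 := abs_le.1 (hM X' a)
      linarith [h1.2, h2.2, h3.1, h4.1]
    · rw [nsmul_eq_mul, Finset.cast_card_sdiff hsub, mul_comm]
  · intro a ha
    rw [siteEnergy_patch Φ X' X ha, siteEnergy_patch Φ X X' ha]
    ring

theorem integral_siteEnergy_eq {ν : ProbabilityMeasure (Config d n)}
    (hν : IsTranslationInvariant ν) (Φ : Interaction d n) (R : ℕ) (a : Site d) :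
    ∫ X, siteEnergy Φ R X a ∂(ν : Measure (Config d n)) =
      ∫ X, siteEnergy Φ R X 0 ∂(ν : Measure (Config d n)) := by
  conv_rhs => rw [← hν a]
  rw [integral_map (continuous_translate a).measurable.aemeasurable
    (continuous_siteEnergy Φ R 0).aestronglyMeasurable]
  simp only [siteEnergy_translate, zero_add]

theorem isStableGroundStateMeasure_of_strictBoundaryCondition {Φ : Interaction d n}
    (hΦ : IsBondHamiltonian Φ) {μ : ProbabilityMeasure (Config d n)}
    (hμ : HasUniqueGroundStateMeasure Φ μ)
    (hμ₀ : ∀ᵐ X ∂(μ : Measure (Config d n)), brokenBonds Φ X = ∅) {r : ℝ}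
    (h : ∀ ar : Arrangement d n, ar.HasRangeLT r → StrictBoundaryCondition Φ μ ar) :
    IsStableGroundStateMeasure Φ r μ := by
  obtain ⟨K, hK0, hK⟩ := exists_abs_relEnergy_le h
  -- With this ε the perturbation outweighs at most half of the broken-bond energy; K + 1 avoids
  -- dividing by zero.
  refine ⟨1 / (2 * (K + 1)), by positivity, fun Ψ hΨ => ?_⟩
  have hε : 1 / (2 * (K + 1)) * K ≤ 1 / 2 := by
    rw [div_mul_eq_mul_div, div_le_div_iff₀ (by positivity) (by norm_num)]
    linarith
  have hlow : ∀ X ∈ (μ : Measure (Config d n)).support, ∀ Y, IsLocalExcitation Y X →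
      1 / 2 * (numBrokenBonds Φ Y : ℝ) ≤ relEnergy (Φ + Ψ) Y X := by
    intro X hX Y hY
    rw [relEnergy_add hY, relEnergy_eq_numBrokenBonds hΦ hY
      (brokenBonds_eq_empty_of_mem_support hΦ hμ₀ hX)]
    have h1 := (abs_le.1 (hK _ Ψ hΨ X hX Y hY)).1
    have h2 := mul_le_mul_of_nonneg_right hε (Nat.cast_nonneg (α := ℝ) (numBrokenBonds Φ Y))
    linarith
  have hμΨ : IsGroundStateMeasure (Φ + Ψ) μ := by
    refine ⟨((hμ μ).2 rfl).1, ?_⟩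
    filter_upwards [Measure.support_mem_ae (μ := (μ : Measure (Config d n)))] with X hX Y hY
    exact le_trans (by positivity) (hlow X hX Y hY)
  intro ν
  refine ⟨fun hν => ?_, fun hν => hν ▸ hμΨ⟩
  obtain ⟨R₁, hR₁⟩ := exists_hasRange Φ
  obtain ⟨R₂, hR₂⟩ := exists_hasRange Ψ
  set R := max R₁ R₂
  have hRΦ : HasRange Φ R := hR₁.mono (le_max_left _ _)
  have hR : HasRange (Φ + Ψ) R := hRΦ.add (hR₂.mono (le_max_right _ _))
  obtain ⟨M, hM⟩ := exists_abs_siteEnergy_le (Φ + Ψ) R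
  obtain ⟨X', hX'⟩ := Measure.nonempty_support
    (IsProbabilityMeasure.ne_zero (μ : Measure (Config d n)))
  have hX'₀ := (brokenBonds_eq_empty_iff_siteEnergy hΦ hRΦ).1
    (brokenBonds_eq_empty_of_mem_support hΦ hμ₀ hX')
  -- Putting X' into X cannot lower the energy, and putting X into X' costs at least half the number
  -- of broken bonds created. The two costs sum to at most 4M times the layer, whence the constant
  -- 8M.
  have hbound : ∀ X, IsGroundStateConfig (Φ + Ψ) X → ∀ N,
      ∑ a ∈ box d N, siteEnergy Φ R X a ≤
        8 * M * ((box d (N + (R + R))).card - (box d N).card) := by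
    intro X hX N
    have h1 := hX _ (isLocalExcitation_patch (box d (N + R)) X' X)
    have h2 := hlow X' hX' _ (isLocalExcitation_patch (box d (N + R)) X X')
    have h3 := relEnergy_patch_add_le hR hM X X' N
    have h4 : (numBrokenBonds Φ (patch (box d (N + R)) X X') : ℝ) =
        ∑ a ∈ box d (N + (R + R)), siteEnergy Φ R (patch (box d (N + R)) X X') a := by
      refine numBrokenBonds_eq_sum hΦ hRΦ fun a ha => ?_
      rw [← Nat.add_assoc] at ha
      rw [siteEnergy_congr (agreeOff_box (fun b hb => patch_of_notMem hb) a ha), hX'₀]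
    have h5 : ∑ a ∈ box d N, siteEnergy Φ R X a ≤
        ∑ a ∈ box d (N + (R + R)), siteEnergy Φ R (patch (box d (N + R)) X X') a := by
      rw [← Finset.sum_congr rfl fun a ha => siteEnergy_patch Φ X X' ha]
      exact Finset.sum_le_sum_of_subset_of_nonneg (box_mono (Nat.le_add_right _ _))
        fun a _ _ => siteEnergy_nonneg hΦ R _ a
    linarith
  set I := ∫ X, siteEnergy Φ R X 0 ∂(ν : Measure (Config d n)) with hI
  -- By translation invariance I is the mean energy per site, so the bound per volume is a
  -- boundary-to-volume ratio that tends to 0.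
  have hIle : ∀ N, I ≤ 8 * M * (((box d (N + (R + R))).card : ℝ) / (box d N).card - 1) := by
    intro N
    have hpos : (0 : ℝ) < (box d N).card := by exact_mod_cast card_box_pos N
    have h1 : ∫ X, ∑ a ∈ box d N, siteEnergy Φ R X a ∂(ν : Measure (Config d n)) =
        (box d N).card * I := by
      rw [integral_finsetSum _ fun a _ =>
        integrable_of_continuous (continuous_siteEnergy Φ R a) _]
      simp only [integral_siteEnergy_eq hν.1, ← hI, Finset.sum_const, nsmul_eq_mul]
    have h2 : ∫ X, ∑ a ∈ box d N, siteEnergy Φ R X a ∂(ν : Measure (Config d n)) ≤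
        8 * M * ((box d (N + (R + R))).card - (box d N).card) := by
      refine (integral_mono_ae (integrable_of_continuous
        (continuous_finsetSum _ fun a _ => continuous_siteEnergy Φ R a) _)
        (integrable_const _) (hν.2.mono fun X hX => hbound X hX N)).trans (le_of_eq ?_)
      simp
    rw [h1] at h2
    rw [div_sub_one hpos.ne', ← mul_div_assoc, le_div_iff₀ hpos]
    linarith
  have hI0 : I = 0 := by
    have hlim := ((tendsto_card_box_ratio (d := d) (R + R)).sub_const 1).const_mul (8 * M)
    rw [sub_self, mul_zero] at hlim
    exact le_antisymm (ge_of_tendsto' hlim hIle)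
      (integral_nonneg fun X => siteEnergy_nonneg hΦ R X 0)
  refine (hμ ν).1 ⟨hν.1, (ae_brokenBonds_eq_empty_of_integral_eq_zero hΦ hRΦ fun a => ?_).mono
    fun X hX => isGroundStateConfig_of_brokenBonds_eq_empty hΦ hX⟩
  rw [integral_siteEnergy_eq hν.1, ← hI, hI0]

/-! ### Stability implies the strict boundary condition -/

theorem siteNorm_neg (v : Site d) : siteNorm (-v) = siteNorm v := by simp [siteNorm]

/-- The interaction which assigns the energy `c` to the particle `s`. -/
def particleInteraction (s : Fin n) (c : ℝ) : Interaction d n where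
  one x := if x = s then c else 0
  two _ _ _ := 0
  two_zero _ _ := rfl
  two_symm _ _ _ := rfl
  finite_range := ⟨0, fun _ _ _ _ => rfl⟩

/-- The interaction which assigns the energy `c` to the pair of particles `s`, `t` at relative
position `v`. -/
def pairInteraction (v : Site d) (hv : v ≠ 0) (s t : Fin n) (c : ℝ) : Interaction d n where
  one _ := 0
  two w x y := if (w = v ∧ x = s ∧ y = t) ∨ (w = -v ∧ x = t ∧ y = s) then c else 0
  two_zero x y := if_neg (by
    rintro (⟨h, -⟩ | ⟨h, -⟩)
    · exact hv h.symm
    · exact hv (neg_eq_zero.1 h.symm))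
  two_symm w x y := by
    simp only [neg_eq_iff_eq_neg, neg_neg]
    congr 1
    rw [or_comm, and_comm (a := y = t), and_comm (a := y = s)]
  finite_range := ⟨siteNorm v, fun w hw x y => if_neg (by
    rintro (⟨rfl, -⟩ | ⟨rfl, -⟩)
    · exact lt_irrefl _ hw
    · exact lt_irrefl _ (siteNorm_neg v ▸ hw))⟩

theorem relEnergy_particleInteraction (s : Fin n) (c : ℝ) {Y X : Config d n}
    (h : IsLocalExcitation Y X) :
    relEnergy (particleInteraction s c) Y X =
      c * ((Arrangement.particle s).countDiff Y X : ℝ) := by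
  rw [relEnergy_eq_countDiff (R := 0) (fun _ _ _ _ => rfl) h]
  simp [particleInteraction]

theorem countDiff_pair_neg (v : Site d) (s t : Fin n) (Y X : Config d n) :
    (Arrangement.pair (-v) t s).countDiff Y X = (Arrangement.pair v s t).countDiff Y X := by
  have himg : ∀ Z : Config d n, (Arrangement.pair (-v) t s).occurrences Z =
      (· + v) '' (Arrangement.pair v s t).occurrences Z := by
    intro Z
    ext a
    simp only [Arrangement.occurrences, Set.mem_ofPred_eq, Set.mem_image]
    constructor
    · rintro ⟨h1, h2⟩
      exact ⟨a + -v, ⟨h2, by simpa using h1⟩, by simp⟩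
    · rintro ⟨b, ⟨h1, h2⟩, rfl⟩
      exact ⟨h2, by simpa using h1⟩
  have hinj : Function.Injective fun a : Site d => a + v := add_left_injective v
  simp only [Arrangement.countDiff, himg, ← Set.image_sdiff hinj,
    Set.ncard_image_of_injective _ hinj]

theorem relEnergy_pairInteraction {v : Site d} (hv : v ≠ 0) (s t : Fin n) (c : ℝ)
    {Y X : Config d n} (h : IsLocalExcitation Y X) :
    relEnergy (pairInteraction v hv s t c) Y X =
      c * ((Arrangement.pair v s t).countDiff Y X : ℝ) := by
  classical
  obtain ⟨R, hR⟩ := exists_subset_box {v, -v}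
  have hvR : v ∈ box d R := hR (by simp)
  have hvR' : -v ∈ box d R := hR (by simp)
  have hrange : HasRange (pairInteraction v hv s t c) R := fun w hw x y => if_neg (by
    rintro (⟨rfl, -⟩ | ⟨rfl, -⟩)
    · exact hw hvR
    · exact hw hvR')
  -- As ℤ^d has no 2-torsion, the two readings of the pair are distinct displacements. Each
  -- contributes c times the same count, which the factor 1/2 compensates.
  have hvv : v ≠ -v := by
    intro heq
    refine hv (funext fun i => ?_)
    have := congrFun heq i
    simp only [Pi.neg_apply, Pi.zero_apply] at this ⊢
    omega
  have htwo : ∀ w x y, (pairInteraction v hv s t c).two w x y =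
      (if w = v then if x = s then if y = t then c else 0 else 0 else 0) +
        (if w = -v then if x = t then if y = s then c else 0 else 0 else 0) := by
    intro w x y
    simp only [pairInteraction, ← ite_and]
    by_cases h1 : w = v ∧ x = s ∧ y = t
    · have h2 : ¬ (w = -v ∧ x = t ∧ y = s) := fun h2 => hvv (h1.1.symm.trans h2.1)
      simp [h1, hvv]
    · simp only [h1, false_or, if_false, zero_add]
  rw [relEnergy_eq_countDiff hrange h]
  simp only [htwo, add_mul, Finset.sum_add_distrib, ite_mul, zero_mul]
  have hone : (pairInteraction v hv s t c).one = fun _ => 0 := rfl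
  simp only [Finset.sum_ite_irrel, Finset.sum_const_zero, Finset.sum_ite_eq', hvR, hvR',
    Finset.mem_univ, if_true, hone, zero_mul, countDiff_pair_neg]
  ring

theorem exists_isSmallPerturbation_relEnergy_eq {ar : Arrangement d n} {r ε c : ℝ}
    (har : ar.HasRangeLT r) (hc : |c| < ε) :
    ∃ Ψ : Interaction d n, IsSmallPerturbation r ε Ψ ∧ ∀ Y X, IsLocalExcitation Y X →
      relEnergy Ψ Y X = c * (ar.countDiff Y X : ℝ) := by
  have hε : |(0 : ℝ)| < ε := by
    rw [abs_zero]
    exact (abs_nonneg c).trans_lt hc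
  cases ar with
  | particle s =>
    refine ⟨particleInteraction s c, ⟨fun _ _ _ _ => rfl, fun x => ?_, fun _ _ _ => hε⟩,
      fun Y X h => relEnergy_particleInteraction s c h⟩
    change |if x = s then c else 0| < ε
    split_ifs
    exacts [hc, hε]
  | pair v s t =>
    refine ⟨pairInteraction v har.1 s t c, ⟨fun w hw x y => if_neg ?_, fun _ => hε,
      fun w x y => ?_⟩, fun Y X h => relEnergy_pairInteraction har.1 s t c h⟩
    · rintro (⟨rfl, -⟩ | ⟨rfl, -⟩)
      · exact hw.not_gt har.2
      · exact hw.not_gt ((siteNorm_neg v).symm ▸ har.2)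
    · change |if _ then c else 0| < ε
      split_ifs
      exacts [hc, hε]

/-- Perturbing by one arrangement with energies ±ε/2 bounds its count from both sides. Only the
persistence of μ as a ground-state measure is needed, not its uniqueness under perturbation. -/
theorem strictBoundaryCondition_of_isGroundStateMeasure {Φ : Interaction d n}
    (hΦ : IsBondHamiltonian Φ) {μ : ProbabilityMeasure (Config d n)}
    (hμ : HasUniqueGroundStateMeasure Φ μ)
    (hμ₀ : ∀ᵐ X ∂(μ : Measure (Config d n)), brokenBonds Φ X = ∅) {r ε : ℝ} (hε : 0 < ε)
    (h : ∀ Ψ, IsSmallPerturbation r ε Ψ → IsGroundStateMeasure (Φ + Ψ) μ)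
    {ar : Arrangement d n} (har : ar.HasRangeLT r) : StrictBoundaryCondition Φ μ ar := by
  -- The energies ±ε/2 give the factor 2/ε; the extra 1, together with B(Y) > 0, makes the
  -- inequality strict.
  refine ⟨2 / ε + 1, by positivity, fun X hX Y hY hne => ?_⟩
  have hpos : (0 : ℝ) < numBrokenBonds Φ Y := by
    exact_mod_cast numBrokenBonds_pos hΦ hμ hμ₀ hX hY hne
  have key : ∀ c : ℝ, |c| < ε → 0 ≤ numBrokenBonds Φ Y + c * (ar.countDiff Y X : ℝ) := by
    intro c hc
    obtain ⟨Ψ, hΨ, hrel⟩ := exists_isSmallPerturbation_relEnergy_eq har hc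
    have hX' := Measure.support_subset_of_isClosed
      (isClosed_setOf_isGroundStateConfig (Φ + Ψ)) (h Ψ hΨ).2 hX Y hY
    rwa [relEnergy_add hY, hrel Y X hY, relEnergy_eq_numBrokenBonds hΦ hY
      (brokenBonds_eq_empty_of_mem_support hΦ hμ₀ hX)] at hX'
  have h1 := key (ε / 2) (by rw [abs_of_pos (by positivity)]; linarith)
  have h2 := key (-(ε / 2)) (by rw [abs_neg, abs_of_pos (by positivity)]; linarith)
  have h3 : |(ar.countDiff Y X : ℝ)| ≤ 2 / ε * numBrokenBonds Φ Y := by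
    rw [div_mul_eq_mul_div, le_div_iff₀ hε]
    rcases abs_cases (ar.countDiff Y X : ℝ) with ⟨h, -⟩ | ⟨h, -⟩ <;> rw [h] <;> linarith
  linarith

end LatticeGas

end

/-! ### The equivalences. -/

theorem theorem1 (d n : ℕ) (Φ : LatticeGas.Interaction d n)
    (hΦ : LatticeGas.IsBondHamiltonian Φ)
    (μ : MeasureTheory.ProbabilityMeasure (LatticeGas.Config d n))
    (hμ : LatticeGas.HasUniqueGroundStateMeasure Φ μ)
    (hμ₀ : ∀ᵐ X ∂(μ : MeasureTheory.Measure (LatticeGas.Config d n)),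
      LatticeGas.brokenBonds Φ X = ∅)
    (r : ℝ) :
    (LatticeGas.IsStableGroundState Φ r μ ↔
      ∀ ar : LatticeGas.Arrangement d n, ar.HasRangeLT r →
        LatticeGas.StrictBoundaryCondition Φ μ ar) ∧
    (LatticeGas.IsStableGroundStateMeasure Φ r μ ↔
      ∀ ar : LatticeGas.Arrangement d n, ar.HasRangeLT r →
        LatticeGas.StrictBoundaryCondition Φ μ ar) := by
  refine ⟨⟨?_, fun h => ?_⟩, ?_, fun h =>
    LatticeGas.isStableGroundStateMeasure_of_strictBoundaryCondition hΦ hμ hμ₀ h⟩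
  · rintro ⟨ε, hε, h⟩ ar har
    exact LatticeGas.strictBoundaryCondition_of_isGroundStateMeasure hΦ hμ hμ₀ hε
      (fun Ψ hΨ => ((h Ψ hΨ μ).2 rfl).isGroundStateMeasure) har
  · obtain ⟨ε, hε, hstable⟩ :=
      LatticeGas.isStableGroundStateMeasure_of_strictBoundaryCondition hΦ hμ hμ₀ h
    exact ⟨ε, hε, fun Ψ hΨ => (hstable Ψ hΨ).hasUniqueGroundState⟩
  · rintro ⟨ε, hε, h⟩ ar har
    exact LatticeGas.strictBoundaryCondition_of_isGroundStateMeasure hΦ hμ hμ₀ hε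
      (fun Ψ hΨ => (h Ψ hΨ μ).2 rfl) har
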